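/- **Setting.** Fix $d\in\mathbb N=\{1,2,\dots\}$ and $T\in(0,\infty)$. For $t\in[0,T]$ let $\Omega^t$ be the space of continuous $\omega:[t,T]\to\mathbb R^d$ with $\omega(t)=0$, with the uniform norm $\|\cdot\|_{t,T}$, where $\|\omega\|_{t,s}=\sup_{r\in[t,s]}|\omega(r)|$. Let $B^t$ be its canonical process, $\mathcal F^t_s=\sigma(B^t_r;\,r\in[t,s])$ the natural filtration, and $\mathcal T^t$ the set of $[t,T]$-valued stopping times of $(\mathcal F^t_s)_{s\in[t,T]}$. Put $\Omega=\Omega^0$, $\mathcal T=\mathcal T^0$. For $t\le s$, $\omega\in\Omega^t$, $\widetilde\omega\in\Omega^s$ let $(\omega\otimes_s\widetilde\omega)(r)=\omega(r)$ for $r<s$ and $=\omega(s)+\widetilde\omega(r)$ for $r\ge s$; let $\Pi^t_s(\omega)(r)=\omega(r)-\omega(s)$, $r\in[s,T]$; and for a random variable $\xi$ and a process $X$ on $\Omega$ let $\xi^{s,\omega}(\widetilde\omega)=\xi(\omega\otimes_s\widetilde\omega)$ and $X^{s,\omega}_r(\widetilde\omega)=X_r(\omega\otimes_s\widetilde\omega)$.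 For a probability $\mathbb P$ on $(\Omega^t,\mathcal F^t_T)$, the shifted probability $\mathbb P^{s,\omega}$ on $(\Omega^s,\mathcal F^s_T)$ is the image under $\Pi^t_s$ of the regular conditional probability of $\mathbb P$ given $\mathcal F^t_s$ at $\omega$. Write $O^s_\delta(\omega)=\{\omega'\in\Omega^t:\|\omega'-\omega\|_{t,s}<\delta\}$ for $\omega\in\Omega^t$. A modulus of continuity is a nondecreasing $\rho:[0,\infty)\to[0,\infty)$ with $\lim_{x\downarrow0}\rho(x)=0$; $\mathfrak M$ is the set of those with $\rho(x)\le C(x^{p_1}\vee x^{p_2})$ for all $x\ge0$, for some $C>0$ and $0<p_1\le p_2$. Let $\mathfrak S$ be the set of pairs $(Y,\wp)$ such that $Y$ is a bounded real process on $[0,T]\times\Omega$ with, for some $\rho_Y\in\mathfrak M$, $|Y_{t_1}(\omega_1)-Y_{t_2}(\omega_2)|\le\rho_Y\big(|t_1-t_2|+\|\omega_1(\cdot\wedge t_1)-\omega_2(\cdot\wedge t_2)\|_{0,T}\big)$ for all $(t_1,\omega_1),(t_2,\omega_2)$; and $\wp\in\mathcal T$ satisfies $|\wp(\omega)-\wp(\omega')|\le\kappa\|\omega-\omega'\|_{0,T}$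 for all $\omega,\omega'\in\Omega$ and some $\kappa>0$. For $(Y,\wp)\in\mathfrak S$ put $\widehat Y_t=Y_{\wp\wedge t}$. For each $t\in[0,T]$ let $\mathcal P_t$ be a set of probabilities on $(\Omega^t,\mathcal F^t_T)$, with $\mathcal P:=\mathcal P_0\neq\emptyset$, such that: * **(P1)** $\mathcal P$ is weakly compact. * **(P2)** For every $\rho\in\mathfrak M$ there is $\widehat\rho\in\mathfrak M$ such that $\sup_{(\mathbb P,\zeta)\in\mathcal P_t\times\mathcal T^t}\mathbb E_{\mathbb P}\big[\rho\big(\delta+\sup_{r\in[\zeta,(\zeta+\delta)\wedge T]}|B^t_r-B^t_\zeta|\big)\big]\le\widehat\rho(\delta)$ for all $t\in[0,T)$ and $\delta>0$. * **(P3)** For all $0\le t<s\le T$ and $\mathbb P\in\mathcal P_t$ there are an extension $(\Omega^t,\mathcal F',\mathbb P')$ of $(\Omega^t,\mathcal F^t_T,\mathbb P)$ and $\Omega'\in\mathcal F'$ with $\mathbb P'(\Omega')=1$ such that $\mathbb P^{s,\widetilde\omega}\in\mathcal P_s$ for all $\widetilde\omega\in\Omega'$. * **(P4)** For every $(Y,\wp)\in\mathfrak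 S$ there is a modulus of continuity $\overline\rho_Y$ such that, for all $0\le t<s\le T$, $\omega\in\Omega$, $\mathbb P\in\mathcal P_t$, rational $\delta>0$, $\lambda\in\mathbb N$, every partition $\{\mathcal A_j\}_{j=0}^\lambda$ of $\Omega^t$ into (possibly empty) sets of $\mathcal F^t_s$ such that for $j=1,\dots,\lambda$ one has $\mathcal A_j\subset O^s_{\delta_j}(\widetilde\omega_j)$ for some rational $\delta_j\in(0,\delta]$ and some $\widetilde\omega_j\in\Omega^t$, and all $\mathbb P_1,\dots,\mathbb P_\lambda\in\mathcal P_s$, there is $\widehat{\mathbb P}\in\mathcal P_t$ with: (i) $\widehat{\mathbb P}(A\cap\mathcal A_0)=\mathbb P(A\cap\mathcal A_0)$ for all $A\in\mathcal F^t_T$; (ii) for all $j=1,\dots,\lambda$ and $A\in\mathcal F^t_s$, $\widehat{\mathbb P}(A\cap\mathcal A_j)=\mathbb P(A\cap\mathcal A_j)$ and, for all $\gamma\in\mathcal T^s$, $\mathbb E_{\widehat{\mathbb P}}\big[\mathbf 1_{A\cap\mathcal A_j}\widehat Y^{t,\omega}_{\gamma(\Pi^t_s)}\big]\ge\mathbb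 E_{\mathbb P}\big[\mathbf 1_{\{\widetilde\omega\in A\cap\mathcal A_j\}}\big(\mathbb E_{\mathbb P_j}[\widehat Y^{s,\omega\otimes_t\widetilde\omega}_\gamma]-\overline\rho_Y(\delta)\big)\big]$. Let $(Y,\wp)\in\mathfrak S$, let $Z_t(\omega)=\sup_{(\mathbb P,\gamma)\in\mathcal P_t\times\mathcal T^t}\mathbb E_{\mathbb P}[\widehat Y^{t,\omega}_\gamma]$, and let $\overline{\mathscr E}_t[\xi](\omega)=\sup_{\mathbb P\in\mathcal P_t}\mathbb E_{\mathbb P}[\xi^{t,\omega}]$ for bounded $\mathcal F_T$-measurable $\xi$. **Theorem.** For every $\omega\in\Omega$ the set $\{t\in[0,T]:Z_t(\omega)=\widehat Y_t(\omega)\}$ has a least element $\widehat\nu(\omega)$, and $\widehat\nu\in\mathcal T$. There is $\widehat{\mathbb P}\in\mathcal P$ such that $$Z_0=\overline{\mathscr E}_0[Z_{\widehat\nu}]=\mathbb E_{\widehat{\mathbb P}}[Z_{\widehat\nu}]=\mathbb E_{\widehat{\mathbb P}}[\widehat Y_{\widehat\nu}],$$ the pair $(\widehat{\mathbb P},\widehat\nu)$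 is optimal, i.e. $\mathbb E_{\widehat{\mathbb P}}[\widehat Y_{\widehat\nu}]=\max_{(\mathbb P,\gamma)\in\mathcal P\times\mathcal T}\mathbb E_{\mathbb P}[\widehat Y_\gamma]$, and for every $\zeta\in\mathcal T$ the random variable $Z_{\widehat\nu\wedge\zeta}$ is bounded and $\mathcal F_T$-measurable with $$Z_0=\overline{\mathscr E}_0[Z_{\widehat\nu\wedge\zeta}]=\mathbb E_{\widehat{\mathbb P}}[Z_{\widehat\nu\wedge\zeta}].$$ -/

import Mathlib

open MeasureTheory ProbabilityTheory Filter Topology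

noncomputable section

namespace RobustStopping

/-- The time interval `[0, T]`. -/
abbrev Time (T : ℝ) : Type := Set.Icc (0 : ℝ) T

instance Time.instZero {T : ℝ} [hT : Fact (0 < T)] : Zero (Time T) :=
  ⟨⟨0, le_rfl, hT.out.le⟩⟩

theorem Time.zero_le {T : ℝ} [Fact (0 < T)] (t : Time T) : 0 ≤ t := t.2.1

instance Time.instCompactSpaceIci {T : ℝ} (t : Time T) : CompactSpace (Set.Ici t) :=
  isCompact_iff_compactSpace.mp isClosed_Ici.isCompact

/-- `ℝ^d` with its Euclidean norm. -/
abbrev State (d : ℕ) : Type := EuclideanSpace ℝ (Fin d)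

/-- The canonical space `Ω^t` of continuous paths `ω : [t, T] → ℝ^d` with `ω(t) = 0`
(inside `Time T`, the interval `[t, T]` is `Set.Ici t`). -/
def Omega (d : ℕ) {T : ℝ} (t : Time T) : Type :=
  {ω : C(Set.Ici t, State d) // ω ⟨t, Set.self_mem_Ici⟩ = 0}

section Canonical

variable {d : ℕ} {T : ℝ}

/-- The metric of `Ω^t` is that of the uniform norm `‖·‖_{t,T}`. -/
instance Omega.instMetricSpace (t : Time T) : MetricSpace (Omega d t) :=
  inferInstanceAs (MetricSpace {ω : C(Set.Ici t, State d) // ω ⟨t, Set.self_mem_Ici⟩ = 0})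

instance Omega.instSecondCountable (t : Time T) : SecondCountableTopology (Omega d t) :=
  inferInstanceAs
    (SecondCountableTopology {ω : C(Set.Ici t, State d) // ω ⟨t, Set.self_mem_Ici⟩ = 0})

/-- The value at time `r ∈ [t, T]` of the path `ω ∈ Ω^t`, that is, `B^t_r(ω)`; written `ω r`.
(For `r < t` it is the value at `t`, which is `0`.) -/
def Omega.eval {t : Time T} (ω : Omega d t) (r : Time T) : State d :=
  ω.1 (Set.projIci t r)

instance Omega.instCoeFun (t : Time T) : CoeFun (Omega d t) (fun _ => Time T → State d) :=
  ⟨Omega.eval⟩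

theorem Omega.continuous_coe {t : Time T} (ω : Omega d t) : Continuous (fun r : Time T => ω r) :=
  ω.1.continuous.comp ((continuous_const.max continuous_id).subtype_mk _)

theorem Omega.continuous_eval (t r : Time T) : Continuous (fun ω : Omega d t => ω r) :=
  (continuous_eval_const (Set.projIci t r)).comp continuous_subtype_val

theorem Omega.start {t : Time T} (ω : Omega d t) : ω t = 0 := by
  have h : Set.projIci t t = ⟨t, Set.self_mem_Ici⟩ := Set.projIci_self t
  change ω.1 (Set.projIci t t) = 0
  rw [h]
  exact ω.2

/-- `F^t_T = σ(B^t_r ; r)`. -/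
instance Omega.instMeasurableSpace (t : Time T) : MeasurableSpace (Omega d t) :=
  ⨆ r : Time T, MeasurableSpace.comap (fun ω : Omega d t => ω r) inferInstance

theorem Omega.measurable_eval (t r : Time T) : Measurable (fun ω : Omega d t => ω r) :=
  Measurable.of_comap_le
    (le_iSup (fun r : Time T => MeasurableSpace.comap (fun ω : Omega d t => ω r) inferInstance) r)

theorem Omega.measurableSet_closedBall {t : Time T} (ω₀ : Omega d t) {ε : ℝ} (hε : 0 ≤ ε) :
    MeasurableSet (Metric.closedBall ω₀ ε) := by
  obtain ⟨D, hDc, hDd⟩ := TopologicalSpace.exists_countable_dense (Time T)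
  have h : Metric.closedBall ω₀ ε = ⋂ r ∈ D, {ω : Omega d t | dist (ω r) (ω₀ r) ≤ ε} := by
    ext ω
    simp only [Metric.mem_closedBall, Set.mem_iInter, Set.mem_ofPred_eq]
    constructor
    · intro hω r _
      exact (ContinuousMap.dist_apply_le_dist (f := ω.1) (g := ω₀.1) _).trans hω
    · intro hω
      have hcl : IsClosed {r : Time T | dist (ω r) (ω₀ r) ≤ ε} :=
        isClosed_le (ω.continuous_coe.dist ω₀.continuous_coe) continuous_const
      have hall : ∀ r : Time T, dist (ω r) (ω₀ r) ≤ ε := fun r =>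
        hcl.closure_subset_iff.mpr (fun x hx => hω x hx) (hDd r)
      refine (ContinuousMap.dist_le (f := ω.1) (g := ω₀.1) hε).mpr fun x => ?_
      have := hall x.1
      simp only [Omega.eval] at this
      rwa [Set.projIci_of_mem x.2] at this
  rw [h]
  exact MeasurableSet.biInter hDc fun r _ =>
    measurableSet_le ((Omega.measurable_eval t r).dist measurable_const) measurable_const

/-- `F^t_T` is the Borel sigma-algebra of the uniform norm. -/
instance Omega.instBorelSpace (t : Time T) : BorelSpace (Omega d t) := by
  refine ⟨le_antisymm ?_ ?_⟩
  · refine iSup_le fun r => ?_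
    rw [← measurable_iff_comap_le]
    exact @Continuous.measurable _ _ _ (borel _) (@OpensMeasurableSpace.mk _ _ (borel _) le_rfl)
      _ _ _ _ (Omega.continuous_eval t r)
  · refine MeasurableSpace.generateFrom_le fun U hU => ?_
    have hball : ∀ x : Omega d t, ∃ ε : ℝ, x ∈ U → 0 < ε ∧ Metric.closedBall x ε ⊆ U := by
      intro x
      by_cases hx : x ∈ U
      · obtain ⟨ε, hε, h⟩ := Metric.nhds_basis_closedBall.mem_iff.mp (IsOpen.mem_nhds (show IsOpen U from hU) hx)
        exact ⟨ε, fun _ => ⟨hε, h⟩⟩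
      · exact ⟨1, fun h => absurd h hx⟩
    choose ε hε using hball
    obtain ⟨S, hSU, hSc, hS⟩ := TopologicalSpace.countable_cover_nhdsWithin
      (f := fun x => Metric.closedBall x (ε x)) (s := U)
      (fun x hx => mem_nhdsWithin_of_mem_nhds (Metric.closedBall_mem_nhds x (hε x hx).1))
    have hU' : U = ⋃ x ∈ S, Metric.closedBall x (ε x) :=
      Set.Subset.antisymm hS (Set.iUnion₂_subset fun x hx => (hε x (hSU hx)).2)
    rw [hU']
    exact MeasurableSet.biUnion hSc fun x hx =>
      Omega.measurableSet_closedBall x (hε x (hSU hx)).1.le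

theorem Omega.isClosed_setOf (t : Time T) :
    IsClosed {ω : C(Set.Ici t, State d) | ω ⟨t, Set.self_mem_Ici⟩ = 0} :=
  isClosed_eq (continuous_eval_const _) continuous_const

instance Omega.instPolishSpace (t : Time T) : PolishSpace (Omega d t) :=
  (Omega.isClosed_setOf (d := d) t).polishSpace

/-- The natural filtration `F^t_s = σ(B^t_r ; r ≤ s)` of the canonical process of `Ω^t`. -/
def filt (d : ℕ) (t : Time T) : Filtration (Time T) (Omega.instMeasurableSpace (d := d) t) :=
  Filtration.natural (fun r (ω : Omega d t) => ω r)
    (fun r => (Omega.measurable_eval t r).stronglyMeasurable)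

/-- The set `𝒯^t` of stopping times of the natural filtration of `Ω^t`, with values in
`[t, T]`. -/
structure StopTime (d : ℕ) (t : Time T) where
  toFun : Omega d t → Time T
  ge_start : ∀ ω, t ≤ toFun ω
  isStoppingTime : IsStoppingTime (filt d t) (fun ω => (toFun ω : WithTop (Time T)))

instance StopTime.instCoeFun (t : Time T) : CoeFun (StopTime d t)
    (fun _ => Omega d t → Time T) := ⟨StopTime.toFun⟩

/-- The truncation `Π^t_s : Ω^t → Ω^s`, `Π^t_s(ω)(r) = ω(r) - ω(s)`. -/
def trunc {t : Time T} (s : Time T) (ω : Omega d t) : Omega d s :=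
  ⟨⟨fun r => ω r - ω s,
    (ω.continuous_coe.comp continuous_subtype_val).sub continuous_const⟩, sub_self _⟩

/-- The concatenation `ω ⊗_s ω'` of `ω ∈ Ω^t` and `ω' ∈ Ω^s` at time `s ≥ t`. -/
def concat {t s : Time T} (hts : t ≤ s) (ω : Omega d t) (ω' : Omega d s) : Omega d t :=
  ⟨⟨fun r => if (r : Time T) < s then ω r else ω s + ω' r, by
      have h : (fun r : Set.Ici t => if (r : Time T) < s then ω r else ω s + ω' r) =
          fun r : Set.Ici t => if s ≤ (r : Time T) then ω s + ω' r else ω r := by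
        funext r
        by_cases hr : (r : Time T) < s
        · rw [if_pos hr, if_neg (not_le.mpr hr)]
        · rw [if_neg hr, if_pos (not_lt.mp hr)]
      rw [h]
      refine Continuous.if_le
        (continuous_const.add (ω'.continuous_coe.comp continuous_subtype_val))
        (ω.continuous_coe.comp continuous_subtype_val)
        continuous_const continuous_subtype_val ?_
      intro r hr
      rw [← hr, ω'.start, add_zero]⟩, by
    change (if t < s then ω t else ω s + ω' t) = 0
    rcases hts.lt_or_eq with h | h
    · rw [if_pos h, ω.start]
    · subst h
      rw [if_neg (lt_irrefl _), ω.start, ω'.start, add_zero]⟩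

/-- `‖ω - ω'‖_{t,s} = sup_{r ∈ [t,s]} |ω(r) - ω'(r)|`. -/
def distUpTo {t : Time T} (s : Time T) (ω ω' : Omega d t) : ℝ :=
  ⨆ r : Set.Icc t s, ‖ω (r : Time T) - ω' (r : Time T)‖

/-- `O^s_δ(ω) = {ω' : ‖ω' - ω‖_{t,s} < δ}`. -/
def ballUpTo {t : Time T} (s : Time T) (δ : ℝ) (ω : Omega d t) : Set (Omega d t) :=
  {ω' | distUpTo s ω' ω < δ}

theorem measurable_trunc {t : Time T} (s : Time T) :
    Measurable (trunc s : Omega d t → Omega d s) := by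
  refine measurable_iff_comap_le.mpr ?_
  rw [Omega.instMeasurableSpace, MeasurableSpace.comap_iSup]
  refine iSup_le fun r => ?_
  rw [MeasurableSpace.comap_comp]
  exact measurable_iff_comap_le.mp
    ((Omega.measurable_eval t (Set.projIci s r : Time T)).sub (Omega.measurable_eval t s))

/-- The shifted probability `P^{s,ω}` on `Ω^s`: the image under `Π^t_s` of the regular conditional
probability of `P` given `F^t_s` at `ω`. As that probability is carried by `ω ⊗_s Ω^s`, this is
`P^{s,ω}(A) = P(ω ⊗_s A | F^t_s)(ω)`. -/
def shiftProb {t : Time T} (P : ProbabilityMeasure (Omega d t)) (s : Time T) (ω : Omega d t) :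
    ProbabilityMeasure (Omega d s) :=
  ⟨(condExpKernel (P : Measure (Omega d t)) (filt d t s) ω).map (trunc s),
    Measure.isProbabilityMeasure_map (measurable_trunc s).aemeasurable⟩

end Canonical

/-- A modulus of continuity on `[0, ∞)`. -/
structure IsModulus (ρ : ℝ → ℝ) : Prop where
  nonneg : ∀ x, 0 ≤ x → 0 ≤ ρ x
  mono : MonotoneOn ρ (Set.Ici 0)
  tendsto_zero : Tendsto ρ (𝓝[>] 0) (𝓝 0)

/-- The class `𝔐` of moduli of continuity with `ρ(x) ≤ C (x^{p₁} ∨ x^{p₂})`. -/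
def InM (ρ : ℝ → ℝ) : Prop :=
  IsModulus ρ ∧ ∃ C p₁ p₂ : ℝ, 0 < C ∧ 0 < p₁ ∧ p₁ ≤ p₂ ∧
    ∀ x : ℝ, 0 ≤ x → ρ x ≤ C * max (x ^ p₁) (x ^ p₂)

/-- Some extension `(Ω, F', P')` of the measure space `(Ω, F, P)` has an `Ω' ∈ F'` with
`P'(Ω') = 1` and `Ω' ⊆ S`. -/
def ExtendsToFull {Ω : Type} {F : MeasurableSpace Ω} (P : Measure Ω) (S : Set Ω) : Prop :=
  ∃ (F' : MeasurableSpace Ω) (hF' : F ≤ F') (P' : @Measure Ω F'),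
    P'.trim hF' = P ∧ ∃ Ω' : Set Ω, MeasurableSet[F'] Ω' ∧ P' Ω' = 1 ∧ Ω' ⊆ S

section Main

variable {d : ℕ} {T : ℝ} [Fact (0 < T)]

/-- `d_∞((t₁, ω₁), (t₂, ω₂)) = |t₁ - t₂| + ‖ω₁(· ∧ t₁) - ω₂(· ∧ t₂)‖_{0,T}`. -/
def dInfty (t₁ : Time T) (ω₁ : Omega d (0 : Time T)) (t₂ : Time T)
    (ω₂ : Omega d (0 : Time T)) : ℝ :=
  |(t₁ : ℝ) - t₂| + ⨆ r : Time T, ‖ω₁ (min r t₁) - ω₂ (min r t₂)‖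

/-- The class `𝔖` of pairs of a bounded process `Y`, uniformly continuous with a modulus in `𝔐`,
and a Lipschitz continuous stopping time `τ`. -/
structure InS (Y : Time T → Omega d (0 : Time T) → ℝ) (τ : StopTime d (0 : Time T)) : Prop where
  bounded : ∃ M : ℝ, 0 < M ∧ ∀ t ω, |Y t ω| ≤ M
  unifCont : ∃ ρ : ℝ → ℝ, InM ρ ∧
    ∀ t₁ ω₁ t₂ ω₂, |Y t₁ ω₁ - Y t₂ ω₂| ≤ ρ (dInfty t₁ ω₁ t₂ ω₂)
  lipschitz : ∃ κ : ℝ, 0 < κ ∧ ∀ ω ω', |(τ ω : ℝ) - τ ω'| ≤ κ * dist ω ω'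

/-- The stopped process `Ŷ_t = Y_{τ ∧ t}`. -/
def stopAt (Y : Time T → Omega d (0 : Time T) → ℝ) (τ : StopTime d (0 : Time T)) :
    Time T → Omega d (0 : Time T) → ℝ :=
  fun t ω => Y (min (τ ω) t) ω

/-- The shifted random variable `ξ^{t,ω}(ω') = ξ(ω ⊗_t ω')`. -/
def shiftRV (ξ : Omega d (0 : Time T) → ℝ) (t : Time T) (ω : Omega d (0 : Time T)) :
    Omega d t → ℝ :=
  fun ω' => ξ (concat t.zero_le ω ω')

/-- The shifted process `X^{t,ω}_r(ω') = X_r(ω ⊗_t ω')`. -/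
def shiftProc (X : Time T → Omega d (0 : Time T) → ℝ) (t : Time T) (ω : Omega d (0 : Time T)) :
    Time T → Omega d t → ℝ :=
  fun r => shiftRV (X r) t ω

/-- The nonlinear expectation `sup_{P ∈ 𝒞_t} E_P[ξ^{t,ω}]`. -/
def nlExp (𝒞 : ∀ t : Time T, Set (ProbabilityMeasure (Omega d t))) (t : Time T)
    (ξ : Omega d (0 : Time T) → ℝ) (ω : Omega d (0 : Time T)) : ℝ :=
  ⨆ P : 𝒞 t, ∫ ω', shiftRV ξ t ω ω' ∂P.1.toMeasure

/-- The Snell envelope `Z_t(ω) = sup_{P ∈ 𝒞_t, γ ∈ 𝒯^t} E_P[X^{t,ω}_γ]` of a process `X`. -/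
def snell (𝒞 : ∀ t : Time T, Set (ProbabilityMeasure (Omega d t)))
    (X : Time T → Omega d (0 : Time T) → ℝ) (t : Time T) (ω : Omega d (0 : Time T)) : ℝ :=
  ⨆ p : 𝒞 t × StopTime d t,
    ∫ ω', shiftProc X t ω (p.2 ω') ω' ∂p.1.1.toMeasure

/-- (P1): `𝒞_0` is weakly compact. -/
def P1 (𝒞 : ∀ t : Time T, Set (ProbabilityMeasure (Omega d t))) : Prop :=
  IsCompact (𝒞 0)

/-- (P2): for every `ρ ∈ 𝔐` some `ρ' ∈ 𝔐` satisfies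
`E_P[ρ(δ + sup_{r ∈ [ζ, (ζ+δ) ∧ T]} |B^t_r - B^t_ζ|)] ≤ ρ'(δ)`
for all `t ∈ [0, T)`, `δ > 0`, `P ∈ 𝒞_t`, `ζ ∈ 𝒯^t`. -/
def P2 (𝒞 : ∀ t : Time T, Set (ProbabilityMeasure (Omega d t))) : Prop :=
  ∀ ρ : ℝ → ℝ, InM ρ → ∃ ρ' : ℝ → ℝ, InM ρ' ∧
    ∀ t : Time T, (t : ℝ) < T → ∀ δ : ℝ, 0 < δ → ∀ P ∈ 𝒞 t, ∀ ζ : StopTime d t,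
      ∫⁻ ω, ENNReal.ofReal
        (ρ (δ + ⨆ r : {r : Time T // ζ ω ≤ r ∧ (r : ℝ) ≤ ζ ω + δ}, ‖ω r.1 - ω (ζ ω)‖))
        ∂P.toMeasure ≤ ENNReal.ofReal (ρ' δ)

/-- (P3): for `t < s` and `P ∈ 𝒞_t`, there are an extension `(Ω^t, F', P')` of `(Ω^t, F^t_T, P)`
and `Ω' ∈ F'` with `P'(Ω') = 1` such that `P^{s,ω} ∈ 𝒞_s` for all `ω ∈ Ω'`. -/
def P3 (𝒞 : ∀ t : Time T, Set (ProbabilityMeasure (Omega d t))) : Prop :=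
  ∀ t s : Time T, t < s → ∀ P ∈ 𝒞 t, ExtendsToFull P.toMeasure {ω | shiftProb P s ω ∈ 𝒞 s}

/-- (P4): weak stability under pasting. The `F^t_s`-partition is `A 0, …, A n`. -/
def P4 (𝒞 : ∀ t : Time T, Set (ProbabilityMeasure (Omega d t))) : Prop :=
  ∀ (Y : Time T → Omega d (0 : Time T) → ℝ) (τ : StopTime d (0 : Time T)), InS Y τ →
    ∃ ρ : ℝ → ℝ, IsModulus ρ ∧
      ∀ t s : Time T, t < s → ∀ ω : Omega d (0 : Time T), ∀ P ∈ 𝒞 t,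
      ∀ δ : ℚ, 0 < δ → ∀ n : ℕ, 1 ≤ n →
      ∀ A : Fin (n + 1) → Set (Omega d t),
        (∀ j, MeasurableSet[filt d t s] (A j)) → Pairwise (Function.onFun Disjoint A) →
        (⋃ j, A j) = Set.univ →
        (∀ j : Fin n, ∃ δ' : ℚ, 0 < δ' ∧ δ' ≤ δ ∧
          ∃ ω₀ : Omega d t, A j.succ ⊆ ballUpTo s δ' ω₀) →
      ∀ Q : Fin n → ProbabilityMeasure (Omega d s), (∀ j, Q j ∈ 𝒞 s) →
      ∃ P' ∈ 𝒞 t,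
        (∀ B : Set (Omega d t), MeasurableSet B →
          P'.toMeasure (B ∩ A 0) =
            P.toMeasure (B ∩ A 0)) ∧
        ∀ j : Fin n, ∀ B : Set (Omega d t), MeasurableSet[filt d t s] B →
          P'.toMeasure (B ∩ A j.succ) =
            P.toMeasure (B ∩ A j.succ) ∧
          ∀ γ : StopTime d s,
            ∫ ω' in B ∩ A j.succ,
                ((∫ ω'', shiftProc (stopAt Y τ) s (concat t.zero_le ω ω') (γ ω'') ω''
                  ∂(Q j).toMeasure) - ρ δ)
              ∂P.toMeasure ≤
            ∫ ω' in B ∩ A j.succ, shiftProc (stopAt Y τ) t ω (γ (trunc s ω')) ω'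
              ∂P'.toMeasure

end Main

end RobustStopping

end

open RobustStopping

open MeasureTheory ProbabilityTheory Filter Topology

noncomputable section

namespace RobustStopping

/-! ### Paths, concatenation and Galmarini's test -/

section Paths

variable {d : ℕ} {T : ℝ}

/-! Write Z for the Snell envelope and Ŷ for the stopped payoff. The proof has three layers.

Regularity. (P2) makes the oscillation of paths after a stopping time small in probability,
uniformly over all laws. As the exercise horizon is Lipschitz in the path, the expected payoff
depends continuously on the past path, uniformly in time, law and stopping time
(`InS.payoff_regular`), and so does its supremum Z.

Dynamic programming. Gluing near-optimal controls on a countable cover of the past by small balls,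
via (P4), gives E_P[Z_s] ≤ Z_t (`InS.integral_snell_le`). Conditioning, via (P3), bounds the value
of stopping after s by E_P[Z_s] (`InS.integral_payoff_le`). Together they give continuity in time,
so Z is jointly continuous (`InS.continuous_snell`). Using (P3) once more, Z is a supermartingale
under every law in `𝒞 0`, and optional sampling follows by discretization.

Optimality. Let H_a be the first time at which Z - Ŷ ≤ a, and ν = H_0. Under an ε-optimal pair (P,
γ) the gap Z - Ŷ at γ has mean at most ε, yet is at least a where γ < H_a; hence E_P[Z_{H_a}] ≥ Z_0
- O(ε) (`InS.le_integral_snell_hitting`). Let Q be a weak limit of such laws as ε tends to 0, by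
(P1). The obstacle is that H_a is only lower semicontinuous in the path. Averaging over the level a
in (b, 2b] removes it: a ↦ H_a(ω) is monotone, hence continuous at almost every level, and at such
levels H_a is continuous at ω (`continuousAt_hitting`). The averaged functional is bounded and
continuous and passes to the limit. Optional sampling under Q replaces the average by the level 2b,
and b → 0 gives E_Q[Z_ν] ≥ Z_0. The supermartingale inequality supplies the converse, and Z = Ŷ at
ν. -/

@[ext]
theorem Omega.ext {t : Time T} {ω ω' : Omega d t} (h : ∀ r, t ≤ r → ω r = ω' r) : ω = ω' := by
  refine Subtype.ext (ContinuousMap.ext fun r => ?_)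
  have := h r.1 r.2
  simp only [Omega.eval] at this
  rwa [Set.projIci_of_mem r.2] at this

theorem Omega.eval_mk {t : Time T} (f : C(Set.Ici t, State d)) (hf) (r : Time T) :
    Omega.eval (⟨f, hf⟩ : Omega d t) r = f (Set.projIci t r) := rfl

theorem Omega.eval_of_le {t : Time T} (ω : Omega d t) {r : Time T} (h : r ≤ t) : ω r = 0 := by
  rw [← ω.start]
  simp only [Omega.eval]
  rw [Set.projIci_of_le h, Set.projIci_self]

theorem Omega.eval_max {t : Time T} (ω : Omega d t) (r : Time T) : ω (max t r) = ω r := by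
  rcases le_total t r with h | h
  · rw [max_eq_right h]
  · rw [max_eq_left h, ω.start, ω.eval_of_le h]

theorem Omega.continuous_uncurry (t : Time T) :
    Continuous (fun p : Time T × Omega d t => p.2 p.1) := by
  have h1 : Continuous (fun p : Time T × Omega d t => Set.projIci t p.1) :=
    ((continuous_const.max continuous_id).subtype_mk _).comp continuous_fst
  exact (continuous_subtype_val.comp continuous_snd).eval h1

theorem Omega.dist_le {t : Time T} {ω ω' : Omega d t} {c : ℝ} (hc : 0 ≤ c)
    (h : ∀ r, ‖ω r - ω' r‖ ≤ c) : dist ω ω' ≤ c := by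
  refine (ContinuousMap.dist_le (f := ω.1) (g := ω'.1) hc).mpr fun x => ?_
  have := h x.1
  simp only [Omega.eval] at this
  rwa [Set.projIci_of_mem x.2, ← dist_eq_norm] at this

theorem Omega.norm_sub_le_dist {t : Time T} (ω ω' : Omega d t) (r : Time T) :
    ‖ω r - ω' r‖ ≤ dist ω ω' := by
  rw [← dist_eq_norm]
  exact ContinuousMap.dist_apply_le_dist (f := ω.1) (g := ω'.1) _

theorem trunc_eval {t : Time T} {s : Time T} (ω : Omega d t) {r : Time T} (h : s ≤ r) :
    trunc s ω r = ω r - ω s := by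
  rw [trunc, Omega.eval_mk, Set.projIci_of_mem (Set.mem_Ici.mpr h)]
  rfl

/-- As `ω'` vanishes up to `s`, one additive formula covers both branches, and even times before
`t`. Later computations with concatenations use it in place of the case split. -/
theorem concat_eval {t s : Time T} (hts : t ≤ s) (ω : Omega d t) (ω' : Omega d s) (r : Time T) :
    concat hts ω ω' r = ω (min r s) + ω' r := by
  have key : ∀ r, t ≤ r → concat hts ω ω' r = ω (min r s) + ω' r := by
    intro r hr
    rw [concat, Omega.eval_mk, Set.projIci_of_mem (Set.mem_Ici.mpr hr)]
    change (if r < s then ω r else ω s + ω' r) = _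
    split_ifs with h
    · rw [min_eq_left h.le, ω'.eval_of_le h.le, add_zero]
    · rw [min_eq_right (not_lt.mp h)]
  rcases le_total t r with h | h
  · exact key r h
  · rw [Omega.eval_of_le _ h, ω.eval_of_le ((min_le_left _ _).trans h),
      ω'.eval_of_le (h.trans hts), add_zero]

theorem concat_eval_of_le {t s : Time T} (hts : t ≤ s) (ω : Omega d t) (ω' : Omega d s)
    {r : Time T} (h : r ≤ s) : concat hts ω ω' r = ω r := by
  rw [concat_eval, min_eq_left h, ω'.eval_of_le h, add_zero]

theorem concat_trunc {t s : Time T} (hts : t ≤ s) (ω : Omega d t) :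
    concat hts ω (trunc s ω) = ω := by
  ext1 r _
  rw [concat_eval]
  rcases le_total s r with h' | h'
  · rw [min_eq_right h', trunc_eval _ h', add_sub_cancel]
  · rw [min_eq_left h', Omega.eval_of_le _ h', add_zero]

theorem concat_congr {t s : Time T} (hts : t ≤ s) {ω₁ ω₂ : Omega d t} (ω' : Omega d s)
    (h : ∀ r ≤ s, ω₁ r = ω₂ r) : concat hts ω₁ ω' = concat hts ω₂ ω' := by
  ext1 r _
  rw [concat_eval, concat_eval, h _ (min_le_right _ _)]

theorem concat_assoc {t u s : Time T} (htu : t ≤ u) (hus : u ≤ s) (ω : Omega d t)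
    (ω' : Omega d u) (ω'' : Omega d s) :
    concat htu ω (concat hus ω' ω'') = concat (htu.trans hus) (concat htu ω ω') ω'' := by
  ext1 r _
  simp only [concat_eval]
  rw [min_assoc, min_eq_right hus, add_assoc]

theorem Omega.continuous_of_eval {X : Type*} [TopologicalSpace X] {t : Time T} {f : X → Omega d t}
    (h : Continuous fun p : X × Time T => f p.1 p.2) : Continuous f := by
  refine Continuous.subtype_mk (f := fun x => (f x).1) ?_ (fun x => (f x).2)
  refine ContinuousMap.continuous_of_continuous_uncurry _ ?_
  have : Function.uncurry (fun (x : X) (y : Set.Ici t) => (f x).1 y) =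
      (fun p : X × Time T => f p.1 p.2) ∘ fun q : X × Set.Ici t => (q.1, q.2.1) := by
    funext q
    change (f q.1).1 q.2 = (f q.1).1 (Set.projIci t q.2.1)
    rw [Set.projIci_of_mem q.2.2]
  rw [this]
  exact h.comp (by fun_prop)

theorem continuous_concat {t s : Time T} (hts : t ≤ s) :
    Continuous fun p : Omega d t × Omega d s => concat hts p.1 p.2 := by
  refine Omega.continuous_of_eval ?_
  simp only [concat_eval]
  exact ((Omega.continuous_uncurry t).comp
    ((continuous_snd.min continuous_const).prodMk (by fun_prop))).add
    ((Omega.continuous_uncurry s).comp (continuous_snd.prodMk (by fun_prop)))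

/-- The path stopped at time `r`. -/
def stopPath {t : Time T} (r : Time T) (ω : Omega d t) : Omega d t :=
  ⟨⟨fun u => ω (min u r), ω.continuous_coe.comp (continuous_subtype_val.min continuous_const)⟩,
    ω.eval_of_le (min_le_left _ _)⟩

theorem stopPath_eval {t : Time T} (r : Time T) (ω : Omega d t) (u : Time T) :
    stopPath r ω u = ω (min u r) := by
  rcases le_total t u with h | h
  · rw [stopPath, Omega.eval_mk, Set.projIci_of_mem (Set.mem_Ici.mpr h)]
    rfl
  · rw [Omega.eval_of_le _ h, ω.eval_of_le ((min_le_left _ _).trans h)]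

theorem measurable_eval_filt {t : Time T} {u r : Time T} (h : u ≤ r) :
    Measurable[filt d t r] fun ω : Omega d t => ω u := by
  refine Measurable.of_comap_le ?_
  refine le_trans ?_ (le_iSup₂_of_le u h le_rfl)
  exact le_rfl

theorem measurable_Omega {X : Type*} {m : MeasurableSpace X} {t : Time T} {f : X → Omega d t}
    (h : ∀ r, Measurable fun x => f x r) : Measurable f := by
  refine measurable_iff_comap_le.mpr ?_
  rw [Omega.instMeasurableSpace, MeasurableSpace.comap_iSup]
  refine iSup_le fun r => ?_
  rw [MeasurableSpace.comap_comp]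
  exact measurable_iff_comap_le.mp (h r)

theorem measurable_stopPath {t : Time T} (r : Time T) :
    Measurable[filt d t r] (stopPath r : Omega d t → Omega d t) := by
  refine measurable_Omega fun u => ?_
  simp only [stopPath_eval]
  exact measurable_eval_filt (min_le_right _ _)

/-- Galmarini's test for events. -/
theorem measurableSet_filt_iff {t r : Time T} {A : Set (Omega d t)} :
    MeasurableSet[filt d t r] A ↔
      MeasurableSet A ∧ ∀ ω ω' : Omega d t, (∀ u ≤ r, ω u = ω' u) → ω ∈ A → ω' ∈ A := by
  constructor
  · intro h
    refine ⟨(filt d t).le r _ h, ?_⟩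
    -- Every coordinate up to `r` is a function of the stopped path, so each event of the filtration
    -- at `r` is a preimage under `stopPath r`.
    have hle : filt d t r ≤ MeasurableSpace.comap (stopPath r : Omega d t → Omega d t)
        inferInstance := by
      refine iSup₂_le fun u hu => ?_
      have : (fun ω : Omega d t => ω u) = (fun ω => ω u) ∘ stopPath r := by
        funext ω
        simp only [Function.comp, stopPath_eval, min_eq_left hu]
      refine le_trans (le_of_eq ?_) ((MeasurableSpace.comap_comp).symm.trans_le
        (MeasurableSpace.comap_mono
        (measurable_iff_comap_le.mp (Omega.measurable_eval (d := d) t u))))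
      exact congrArg (fun f : Omega d t → State d => MeasurableSpace.comap f inferInstance) this
    obtain ⟨B, -, rfl⟩ := hle A h
    intro ω ω' h1 h2
    have : stopPath r ω = stopPath r ω' := by
      ext1 u _
      rw [stopPath_eval, stopPath_eval, h1 _ (min_le_right _ _)]
    simpa only [Set.mem_preimage, this] using h2
  · rintro ⟨hA, h⟩
    have : A = stopPath r ⁻¹' A := by
      ext ω
      have : ∀ u ≤ r, ω u = stopPath r ω u := fun u hu => by
        rw [stopPath_eval, min_eq_left hu]
      exact ⟨h _ _ this, h _ _ fun u hu => (this u hu).symm⟩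
    rw [this]
    exact measurable_stopPath r hA

theorem StopTime.measurableSet_le {t : Time T} (γ : StopTime d t) (r : Time T) :
    MeasurableSet[filt d t r] {ω | γ ω ≤ r} := by
  have := γ.isStoppingTime r
  simpa using this

theorem StopTime.measurable {t : Time T} (γ : StopTime d t) : Measurable γ :=
  measurable_of_Iic fun r => (filt d t).le r _ (γ.measurableSet_le r)

/-- Galmarini's test for stopping times. -/
theorem StopTime.congr {t : Time T} (γ : StopTime d t) {r : Time T} {ω ω' : Omega d t}
    (h : ∀ u ≤ r, ω u = ω' u) (hr : γ ω ≤ r) : γ ω' = γ ω := by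
  have key : ∀ r ω ω', (∀ u ≤ r, ω u = ω' u) → γ ω ≤ r → γ ω' ≤ r := fun r ω ω' h hr =>
    (measurableSet_filt_iff.mp (γ.measurableSet_le r)).2 ω ω' h hr
  have h1 : γ ω' ≤ γ ω := key _ ω ω' (fun u hu => h u (hu.trans hr)) le_rfl
  exact le_antisymm h1 (key _ ω' ω (fun u hu => (h u (hu.trans (h1.trans hr))).symm) le_rfl)

theorem StopTime.min_congr {t : Time T} (γ : StopTime d t) {r : Time T} {ω ω' : Omega d t}
    (h : ∀ u ≤ r, ω u = ω' u) : min (γ ω') r = min (γ ω) r := by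
  by_cases h1 : γ ω ≤ r
  · rw [γ.congr h h1]
  · by_cases h2 : γ ω' ≤ r
    · rw [γ.congr (fun u hu => (h u hu).symm) h2]
    · rw [min_eq_right (not_le.mp h1).le, min_eq_right (not_le.mp h2).le]

/-- Stopping times from Galmarini's test. -/
def StopTime.mk' {t : Time T} (γ : Omega d t → Time T) (hge : ∀ ω, t ≤ γ ω) (hm : Measurable γ)
    (h : ∀ ω ω', (∀ u ≤ γ ω, ω u = ω' u) → γ ω' ≤ γ ω) : StopTime d t where
  toFun := γ
  ge_start := hge
  isStoppingTime r := by
    have : MeasurableSet[filt d t r] {ω | γ ω ≤ r} :=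
      measurableSet_filt_iff.mpr ⟨hm measurableSet_Iic, fun ω ω' h1 h2 =>
        (h ω ω' fun u hu => h1 u (hu.trans h2)).trans h2⟩
    simpa using this

/-- A constant stopping time. -/
def StopTime.const (d : ℕ) {t s : Time T} (h : t ≤ s) : StopTime d t :=
  StopTime.mk' (fun _ => s) (fun _ => h) measurable_const fun _ _ _ => le_rfl

/-- The minimum of two stopping times. -/
def StopTime.min {t : Time T} (γ γ' : StopTime d t) : StopTime d t :=
  StopTime.mk' (fun ω => Min.min (γ ω) (γ' ω)) (fun ω => le_min (γ.ge_start ω) (γ'.ge_start ω))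
    (γ.measurable.min γ'.measurable) fun ω ω' h => by
      rcases le_total (γ ω) (γ' ω) with h1 | h1
      · rw [min_eq_left h1] at h ⊢
        exact (min_le_left _ _).trans (γ.congr h le_rfl).le
      · rw [min_eq_right h1] at h ⊢
        exact (min_le_right _ _).trans (γ'.congr h le_rfl).le

/-- The maximum of two stopping times. -/
def StopTime.max {t : Time T} (γ γ' : StopTime d t) : StopTime d t :=
  StopTime.mk' (fun ω => Max.max (γ ω) (γ' ω)) (fun ω => (γ.ge_start ω).trans (le_max_left _ _))
    (γ.measurable.max γ'.measurable) fun _ _ h =>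
      (max_le_max (γ.congr h (le_max_left _ _)).le (γ'.congr h (le_max_right _ _)).le)

/-- The shifted stopping time `γ^{s,ω} ∨ s`. -/
def StopTime.shift {t s : Time T} (hts : t ≤ s) (γ : StopTime d t) (ω : Omega d t) :
    StopTime d s :=
  StopTime.mk' (fun ω' => Max.max s (γ (concat hts ω ω'))) (fun _ => le_max_left _ _)
    (measurable_const.max (γ.measurable.comp
      ((continuous_concat hts).comp (by fun_prop : Continuous fun ω' => (ω, ω'))).measurable))
    fun ω' ω'' h => by
      refine max_le_max le_rfl (γ.congr (r := Max.max s (γ (concat hts ω ω'))) ?_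
        (le_max_right _ _)).le
      intro u hu
      rw [concat_eval, concat_eval, h u hu]

end Paths

/-! ### Continuity of the payoff and oscillation of paths -/

section Estimates

/-- The limit at 0 is one-sided and says nothing about `ρ 0`; monotonicity transfers the bound at `c
/ 2` to all smaller arguments, 0 included. -/
theorem IsModulus.exists_le {ρ : ℝ → ℝ} (h : IsModulus ρ) {ε : ℝ} (hε : 0 < ε) :
    ∃ c, 0 < c ∧ ∀ x, 0 ≤ x → x ≤ c → ρ x ≤ ε := by
  obtain ⟨c, hc, h1⟩ := Metric.tendsto_nhdsWithin_nhds.mp h.tendsto_zero ε hε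
  refine ⟨c / 2, by positivity, fun x hx hxc => ?_⟩
  have h2 : ρ (c / 2) < ε := by
    have := h1 (show c / 2 ∈ Set.Ioi 0 by simp; positivity)
      (by rw [Real.dist_eq, sub_zero, abs_of_pos (by positivity)]; linarith)
    rw [Real.dist_eq, sub_zero] at this
    exact (le_abs_self _).trans_lt this
  exact (h.mono hx (show (0 : ℝ) ≤ c / 2 by positivity) hxc).trans h2.le

/-- Integrals of bounded functions which are close off a small event are close. -/
theorem integral_le_integral_add_of_close {Ω : Type*} [MeasurableSpace Ω] (P : Measure Ω)
    [IsProbabilityMeasure P] {f g : Ω → ℝ} (hf : Measurable f) (hg : Measurable g) {M : ℝ}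
    (hM : 0 ≤ M) (hfM : ∀ ω, |f ω| ≤ M) (hgM : ∀ ω, |g ω| ≤ M) {E : Set Ω}
    (hE : MeasurableSet E) {ε ε' : ℝ} (hPE : P E ≤ ENNReal.ofReal ε') (hε : 0 ≤ ε)
    (hε' : 0 ≤ ε') (h : ∀ ω, ω ∉ E → f ω ≤ g ω + ε) :
    ∫ ω, f ω ∂P ≤ ∫ ω, g ω ∂P + (ε + 2 * M * ε') := by
  have hfi : Integrable f P := .of_bound hf.aestronglyMeasurable M (by simpa using ae_of_all _ hfM)
  have hgi : Integrable g P := .of_bound hg.aestronglyMeasurable M (by simpa using ae_of_all _ hgM)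
  have hi : Integrable (E.indicator fun _ : Ω => 2 * M) P := (integrable_const _).indicator hE
  have h1 : ∫ ω, f ω ∂P ≤ ∫ ω, (g ω + (ε + E.indicator (fun _ => 2 * M) ω)) ∂P := by
    refine integral_mono hfi (hgi.add ((integrable_const _).add hi)) fun ω => ?_
    by_cases hω : ω ∈ E
    · simp only [Set.indicator_of_mem hω]
      linarith [abs_le.mp (hfM ω), abs_le.mp (hgM ω)]
    · simp only [Set.indicator_of_notMem hω]
      linarith [h ω hω]
  have h3 : ∫ ω, (ε + E.indicator (fun _ => 2 * M) ω) ∂P = ε + P.real E * (2 * M) := by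
    rw [integral_add (integrable_const _) hi, integral_const, integral_indicator_const _ hE]
    simp
  rw [integral_add hgi (by exact (integrable_const _).add hi), h3] at h1
  have h2 : P.real E ≤ ε' := ENNReal.toReal_le_of_le_ofReal hε' hPE
  nlinarith

variable {d : ℕ} {T : ℝ}

theorem Omega.exists_modulus {t : Time T} (ω : Omega d t) {ε : ℝ} (hε : 0 < ε) :
    ∃ δ, 0 < δ ∧ ∀ r r' : Time T, |(r : ℝ) - r'| ≤ δ → ‖ω r - ω r'‖ ≤ ε := by
  have := CompactSpace.uniformContinuous_of_continuous ω.continuous_coe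
  obtain ⟨δ, hδ, h⟩ := Metric.uniformContinuous_iff.mp this ε hε
  refine ⟨δ / 2, by positivity, fun r r' hr => ?_⟩
  rw [← dist_eq_norm]
  refine (h ?_).le
  rw [Subtype.dist_eq, Real.dist_eq]
  linarith

theorem Time.abs_min_sub_min_le (r t t' : Time T) :
    |((min r t : Time T) : ℝ) - (min r t' : Time T)| ≤ |(t : ℝ) - t'| := by
  have := abs_min_sub_min_le_max (r : ℝ) t r t'
  simpa using this

theorem continuous_concat_right {t s : Time T} (hts : t ≤ s) (ω : Omega d t) :
    Continuous fun ω' : Omega d s => concat hts ω ω' :=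
  (continuous_concat hts).comp (continuous_const.prodMk continuous_id)

/-- The event that the path moves by at least `c` within time `δ` after `ζ`. -/
def oscEvent {t : Time T} (ζ : StopTime d t) (δ c : ℝ) : Set (Omega d t) :=
  {ω | ∃ r : Time T, ζ ω ≤ r ∧ (r : ℝ) ≤ ζ ω + δ ∧ c ≤ ‖ω r - ω (ζ ω)‖}

/-- In terms of pairs (start time, path) the event is the projection of a closed set along a compact
time axis, hence closed; it is then pulled back along ω ↦ (ζ ω, ω). -/
theorem measurableSet_oscEvent {t : Time T} (ζ : StopTime d t) (δ c : ℝ) :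
    MeasurableSet (oscEvent ζ δ c) := by
  have hcl : IsClosed {p : Time T × Omega d t |
      ∃ r : Time T, p.1 ≤ r ∧ (r : ℝ) ≤ p.1 + δ ∧ c ≤ ‖p.2 r - p.2 p.1‖} := by
    have h1 : IsClosed {q : Time T × (Time T × Omega d t) |
        q.2.1 ≤ q.1 ∧ (q.1 : ℝ) ≤ q.2.1 + δ ∧ c ≤ ‖q.2.2 q.1 - q.2.2 q.2.1‖} := by
      have a1 : Continuous fun q : Time T × (Time T × Omega d t) => q.1 := continuous_fst
      have a2 : Continuous fun q : Time T × (Time T × Omega d t) => q.2.1 :=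
        continuous_fst.comp continuous_snd
      refine (isClosed_le a2 a1).inter ((isClosed_le (continuous_subtype_val.comp a1)
        ((continuous_subtype_val.comp a2).add continuous_const)).inter
        (isClosed_le continuous_const (Continuous.norm (Continuous.sub ?_ ?_))))
      · exact (Omega.continuous_uncurry t).comp
          (by fun_prop : Continuous fun q : Time T × (Time T × Omega d t) => (q.1, q.2.2))
      · exact (Omega.continuous_uncurry t).comp continuous_snd
    have h2 := isClosedMap_snd_of_compactSpace _ h1
    convert h2 using 1
    ext p
    simp
  exact (ζ.measurable.prodMk measurable_id) hcl.measurableSet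

theorem oscEvent_mono {t : Time T} (ζ : StopTime d t) {δ δ' : ℝ} (h : δ ≤ δ') (c : ℝ) :
    oscEvent ζ δ c ⊆ oscEvent ζ δ' c := fun _ ⟨r, h1, h2, h3⟩ => ⟨r, h1, by linarith, h3⟩

theorem norm_sub_le_of_notMem_oscEvent {t : Time T} {ζ : StopTime d t} {δ c : ℝ}
    {ω : Omega d t} (h : ω ∉ oscEvent ζ δ c) {r r' : Time T} (h1 : ζ ω ≤ r)
    (h2 : (r : ℝ) ≤ ζ ω + δ) (h1' : ζ ω ≤ r') (h2' : (r' : ℝ) ≤ ζ ω + δ) :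
    ‖ω r - ω r'‖ ≤ 2 * c := by
  simp only [oscEvent, Set.mem_ofPred_eq, not_exists, not_and, not_le] at h
  have a := h r h1 h2
  have b := h r' h1' h2'
  have := norm_sub_le_norm_sub_add_norm_sub (ω r) (ω (ζ ω)) (ω r')
  rw [norm_sub_rev (ω (ζ ω))] at this
  linarith

variable [Fact (0 < T)]

theorem dInfty_le {t₁ t₂ : Time T} {ω₁ ω₂ : Omega d (0 : Time T)} {a K : ℝ}
    (ha : |(t₁ : ℝ) - t₂| ≤ a) (h : ∀ r, ‖ω₁ (min r t₁) - ω₂ (min r t₂)‖ ≤ K) :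
    dInfty t₁ ω₁ t₂ ω₂ ≤ a + K :=
  haveI : Nonempty (Time T) := ⟨0⟩
  add_le_add ha (ciSup_le h)

theorem dInfty_nonneg (t₁ t₂ : Time T) (ω₁ ω₂ : Omega d (0 : Time T)) :
    0 ≤ dInfty t₁ ω₁ t₂ ω₂ :=
  add_nonneg (abs_nonneg _) (Real.iSup_nonneg fun _ => norm_nonneg _)

variable {Y : Time T → Omega d (0 : Time T) → ℝ} {τ : StopTime d (0 : Time T)}

theorem InS.exists_le (hY : InS Y τ) {ε : ℝ} (hε : 0 < ε) :
    ∃ c, 0 < c ∧ ∀ (t₁ : Time T) ω₁ (t₂ : Time T) ω₂, |(t₁ : ℝ) - t₂| ≤ c →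
      (∀ r, ‖ω₁ (min r t₁) - ω₂ (min r t₂)‖ ≤ c) → |Y t₁ ω₁ - Y t₂ ω₂| ≤ ε := by
  obtain ⟨ρ, hρ, h⟩ := hY.unifCont
  obtain ⟨c, hc, hc'⟩ := hρ.1.exists_le hε
  refine ⟨c / 2, by positivity, fun t₁ ω₁ t₂ ω₂ h1 h2 => (h _ _ _ _).trans
    (hc' _ (dInfty_nonneg _ _ _ _) ((dInfty_le h1 h2).trans (by linarith)))⟩

/-- Adaptedness of `Y` is a consequence of its modulus: the two points are at distance 0 for
`dInfty`, and `ρ 0` is below every positive number. -/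
theorem InS.congr (hY : InS Y τ) {t : Time T} {ω ω' : Omega d (0 : Time T)}
    (h : ∀ r ≤ t, ω r = ω' r) : Y t ω = Y t ω' := by
  refine sub_eq_zero.mp (abs_nonpos_iff.mp (le_of_forall_pos_le_add fun ε hε => ?_))
  obtain ⟨c, hc, hc'⟩ := hY.exists_le hε
  rw [zero_add]
  refine hc' _ _ _ _ (by simpa using hc.le) fun r => ?_
  rw [h _ (min_le_right _ _), sub_self, norm_zero]
  exact hc.le

/-- Moving the time also moves the point where the path is stopped; the uniform continuity of the
fixed path `p.2` absorbs this. -/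
theorem InS.continuous (hY : InS Y τ) :
    Continuous fun p : Time T × Omega d (0 : Time T) => Y p.1 p.2 := by
  refine Metric.continuous_iff.mpr fun p ε hε => ?_
  obtain ⟨c, hc, hc'⟩ := hY.exists_le (half_pos hε)
  obtain ⟨δ, hδ, hδ'⟩ := p.2.exists_modulus (half_pos hc)
  refine ⟨min (c / 2) δ, by positivity, fun q hq => ?_⟩
  have h1 := (max_lt_iff.mp hq).1.trans_le (min_le_left _ _)
  have h2 := (max_lt_iff.mp hq).1.trans_le (min_le_right _ _)
  have h3 := (max_lt_iff.mp hq).2.trans_le (min_le_left _ _)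
  rw [Subtype.dist_eq, Real.dist_eq] at h1 h2
  rw [Real.dist_eq]
  refine (hc' _ _ _ _ (by linarith) fun r => ?_).trans_lt (half_lt_self hε)
  have h4 := hδ' (min r q.1) (min r p.1) ((Time.abs_min_sub_min_le _ _ _).trans h2.le)
  have h5 := Omega.norm_sub_le_dist q.2 p.2 (min r q.1)
  calc ‖q.2 (min r q.1) - p.2 (min r p.1)‖
      ≤ ‖q.2 (min r q.1) - p.2 (min r q.1)‖ + ‖p.2 (min r q.1) - p.2 (min r p.1)‖ :=
        norm_sub_le_norm_sub_add_norm_sub _ _ _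
    _ ≤ c := by linarith

theorem InS.continuous_stopTime (hY : InS Y τ) : Continuous τ := by
  obtain ⟨κ, hκ, h⟩ := hY.lipschitz
  have : LipschitzWith ⟨κ, hκ.le⟩ τ := LipschitzWith.of_dist_le_mul fun ω ω' => by
    rw [Subtype.dist_eq, Real.dist_eq]
    exact h ω ω'
  exact this.continuous

theorem InS.continuous_stopAt (hY : InS Y τ) :
    Continuous fun p : Time T × Omega d (0 : Time T) => stopAt Y τ p.1 p.2 :=
  hY.continuous.comp (((hY.continuous_stopTime.comp continuous_snd).min continuous_fst).prodMk
    continuous_snd)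

theorem InS.stopAt_congr (hY : InS Y τ) {t : Time T} {ω ω' : Omega d (0 : Time T)}
    (h : ∀ r ≤ t, ω r = ω' r) : stopAt Y τ t ω = stopAt Y τ t ω' := by
  unfold stopAt
  rw [τ.min_congr h]
  exact hY.congr fun r hr => h r (hr.trans (min_le_right _ _))

/-- The payoff `Ŷ^{t,ω}_γ` on `Ω^t`. -/
def payoff (Y : Time T → Omega d (0 : Time T) → ℝ) (τ : StopTime d (0 : Time T)) (t : Time T)
    (ω : Omega d (0 : Time T)) (γ : StopTime d t) : Omega d t → ℝ :=
  fun ω' => shiftProc (stopAt Y τ) t ω (γ ω') ω'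

theorem payoff_apply (t : Time T)
    (ω : Omega d (0 : Time T)) (γ : StopTime d t) (ω' : Omega d t) :
    payoff Y τ t ω γ ω' = stopAt Y τ (γ ω') (concat t.zero_le ω ω') := rfl

theorem InS.measurable_payoff (hY : InS Y τ) (t : Time T)
    (ω : Omega d (0 : Time T)) (γ : StopTime d t) : Measurable (payoff Y τ t ω γ) :=
  hY.continuous_stopAt.measurable.comp (γ.measurable.prodMk
    (continuous_concat_right t.zero_le ω).measurable)

theorem concat_zero (ω₀ ω : Omega d (0 : Time T)) : concat (Time.zero_le 0) ω₀ ω = ω := by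
  ext1 r h
  rw [concat_eval, min_eq_right h, ω₀.start, zero_add]

variable {𝒞 : ∀ t : Time T, Set (ProbabilityMeasure (Omega d t))}

theorem inM_id : InM fun x => x :=
  ⟨⟨fun _ h => h, fun _ _ _ _ h => h, tendsto_id.mono_left nhdsWithin_le_nhds⟩,
    1, 1, 1, one_pos, one_pos, le_rfl, fun x _ => by simp⟩

/-- Uniform smallness of the oscillation of the paths under the laws in the `𝒞 t`. -/
theorem P2.exists_oscEvent_le (hP2 : P2 𝒞) {c ε : ℝ} (hc : 0 < c) (hε : 0 < ε) :
    ∃ δ, 0 < δ ∧ ∀ t, ∀ P ∈ 𝒞 t, ∀ ζ : StopTime d t,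
      P.toMeasure (oscEvent ζ δ c) ≤ ENNReal.ofReal ε := by
  -- With the identity as modulus, (P2) bounds the mean oscillation, and Markov's inequality bounds
  -- the event. The target `ε * c` becomes `ε` after division by `c`.
  obtain ⟨ρ', hρ', h⟩ := hP2 _ inM_id
  obtain ⟨δ, hδ, hδ'⟩ := hρ'.1.exists_le (mul_pos hε hc)
  refine ⟨δ, hδ, fun t P hP ζ => ?_⟩
  rcases (show (t : ℝ) ≤ T from t.2.2).lt_or_eq with ht | ht
  · have h1 := h t ht δ hδ P hP ζ
    have h2 : ∫⁻ ω, (oscEvent ζ δ c).indicator (fun _ => ENNReal.ofReal c) ω ∂P.toMeasure ≤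
        ENNReal.ofReal (ε * c) := by
      refine le_trans (lintegral_mono (Set.indicator_le fun ω hω =>
        ENNReal.ofReal_le_ofReal ?_)) (h1.trans (ENNReal.ofReal_le_ofReal (hδ' δ hδ.le le_rfl)))
      obtain ⟨r, hr1, hr2, hr3⟩ := hω
      have hbdd : BddAbove (Set.range fun r : {r : Time T // ζ ω ≤ r ∧ (r : ℝ) ≤ ζ ω + δ} =>
          ‖ω r.1 - ω (ζ ω)‖) := by
        obtain ⟨K, hK⟩ := (isCompact_range
          ((ω.continuous_coe.sub (continuous_const (y := ω (ζ ω)))).norm)).bddAbove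
        exact ⟨K, by rintro _ ⟨r, rfl⟩; exact hK ⟨r.1, rfl⟩⟩
      have := le_ciSup hbdd ⟨r, hr1, hr2⟩
      simp only at this
      linarith
    rw [lintegral_indicator_const (measurableSet_oscEvent ζ δ c),
      ENNReal.ofReal_mul hε.le, mul_comm] at h2
    exact (ENNReal.mul_le_mul_iff_left (by simpa using hc) ENNReal.ofReal_ne_top).mp h2
  -- (P2) does not cover `t = T`, where the only path is zero and never moves.
  · have : oscEvent ζ δ c = ∅ := by
      refine Set.eq_empty_of_forall_notMem fun ω ⟨r, _, _, hr⟩ => ?_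
      have key : ∀ r : Time T, ω r = 0 := fun r => ω.eval_of_le (by
        rw [← Subtype.coe_le_coe, ht]; exact r.2.2)
      rw [key, key, sub_zero, norm_zero] at hr
      linarith
    rw [this, measure_empty]
    exact zero_le

end Estimates

/-! ### Dependence of the Snell envelope on the past path -/

section Regularity

variable {d : ℕ} {T : ℝ}

/-- Stopping one path at two times changes it only through its oscillation between those times. -/
theorem Omega.norm_min_sub_min_le {t : Time T} (w : Omega d t) {u u' : Time T} {K : ℝ}
    (hK : 0 ≤ K)
    (h : ∀ a b : Time T, min u u' ≤ a → a ≤ max u u' → min u u' ≤ b → b ≤ max u u' →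
      ‖w a - w b‖ ≤ K) (r : Time T) : ‖w (min r u) - w (min r u')‖ ≤ K := by
  rcases le_total r (min u u') with hr | hr
  · rw [min_eq_left (hr.trans (min_le_left _ _)), min_eq_left (hr.trans (min_le_right _ _)),
      sub_self, norm_zero]
    exact hK
  · exact h _ _ (le_min hr (min_le_left _ _)) ((min_le_right _ _).trans (le_max_left _ _))
      (le_min hr (min_le_right _ _)) ((min_le_right _ _).trans (le_max_right _ _))

/-- An increment of the concatenation splits into an increment of the past, at most `c`, and one of
the future, at most `2 * c` off the oscillation event. -/
theorem norm_concat_sub_concat_le {t s : Time T} (hts : t ≤ s) {ω : Omega d t} {ω' : Omega d s}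
    {δ c : ℝ} {ζ : StopTime d s}
    (h1 : ∀ r r' : Time T, |(r : ℝ) - r'| ≤ δ → ‖ω r - ω r'‖ ≤ c) (h2 : ω' ∉ oscEvent ζ δ c)
    {a b : Time T} (hab : |(a : ℝ) - b| ≤ δ) (ha : ζ ω' ≤ max s a)
    (ha' : ((max s a : Time T) : ℝ) ≤ ζ ω' + δ) (hb : ζ ω' ≤ max s b)
    (hb' : ((max s b : Time T) : ℝ) ≤ ζ ω' + δ) :
    ‖concat hts ω ω' a - concat hts ω ω' b‖ ≤ 3 * c := by
  rw [concat_eval, concat_eval, add_sub_add_comm, ← ω'.eval_max a, ← ω'.eval_max b]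
  have h3 := norm_sub_le_of_notMem_oscEvent h2 ha ha' hb hb'
  have h4 := h1 (min a s) (min b s) (by
    rw [min_comm a, min_comm b]; exact (Time.abs_min_sub_min_le _ _ _).trans hab)
  exact (norm_add_le _ _).trans (by linarith)

theorem norm_concat_sub_concat_left_le {t s : Time T} (hts : t ≤ s) {ω ω₁ : Omega d t}
    (ω' : Omega d s) {c : ℝ} (h : ∀ r ≤ s, ‖ω r - ω₁ r‖ ≤ c) (r : Time T) :
    ‖concat hts ω ω' r - concat hts ω₁ ω' r‖ ≤ c := by
  rw [concat_eval, concat_eval, add_sub_add_right_eq_sub]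
  exact h _ (min_le_right _ _)

theorem Time.eq_of_coe_eq {t r : Time T} (h : (t : ℝ) = T) (h' : t ≤ r) : r = t :=
  le_antisymm (by rw [← Subtype.coe_le_coe, h]; exact r.2.2) h'

theorem abs_integral_le_of_abs_le {Ω : Type*} [MeasurableSpace Ω] (P : Measure Ω)
    [IsProbabilityMeasure P] {f : Ω → ℝ} {M : ℝ} (h : ∀ ω, |f ω| ≤ M) : |∫ ω, f ω ∂P| ≤ M := by
  have := norm_integral_le_of_norm_le_const (μ := P) (f := f) (C := M)
    (ae_of_all _ fun ω => by simpa using h ω)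
  simpa using this

variable [Fact (0 < T)] {Y : Time T → Omega d (0 : Time T) → ℝ} {τ : StopTime d (0 : Time T)}
  {𝒞 : ∀ t : Time T, Set (ProbabilityMeasure (Omega d t))}

theorem abs_payoff_le {M : ℝ} (hM : ∀ t ω, |Y t ω| ≤ M) (t : Time T) (ω : Omega d (0 : Time T))
    (γ : StopTime d t) (ω' : Omega d t) : |payoff Y τ t ω γ ω'| ≤ M := hM _ _

/-- The expected payoff is continuous in the past path, uniformly in the time, the law and the
stopping time. -/
theorem InS.payoff_regular (hY : InS Y τ) (hP2 : P2 𝒞) (ω : Omega d (0 : Time T)) {ε : ℝ}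
    (hε : 0 < ε) : ∃ η, 0 < η ∧ ∀ t, ∀ ω₁ : Omega d (0 : Time T),
      (∀ r ≤ t, ‖ω r - ω₁ r‖ ≤ η) → ∀ P ∈ 𝒞 t, ∀ γ : StopTime d t,
      |∫ ω', payoff Y τ t ω γ ω' ∂P.toMeasure - ∫ ω', payoff Y τ t ω₁ γ ω' ∂P.toMeasure| ≤ ε := by
  obtain ⟨M, hM0, hM⟩ := hY.bounded
  obtain ⟨κ, hκ, hτ⟩ := hY.lipschitz
  -- The budget `c` for the stopped paths is spent as `3 * (c / 4)` for the oscillation of one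
  -- concatenated path between the two stopping times and `c / 4` for the distance between the two
  -- pasts. The bad event, of probability at most `ε / (4 * M)`, costs the other `ε / 2`.
  obtain ⟨c, hc, hYc⟩ := hY.exists_le (half_pos hε)
  have hc4 : 0 < c / 4 := by positivity
  obtain ⟨δ₁, hδ₁, hω⟩ := ω.exists_modulus hc4
  obtain ⟨δ₂, hδ₂, hosc⟩ := hP2.exists_oscEvent_le hc4 (show 0 < ε / (4 * M) by positivity)
  set δ := min (min δ₁ δ₂) c with hδdef
  have hδ : 0 < δ := by positivity
  refine ⟨min (c / 4) (δ / κ), by positivity, fun t ω₁ hω₁ P hP γ => ?_⟩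
  -- A stopping time opening the window in which the two exercise times can differ; the radius `δ /
  -- κ` and the Lipschitz bound keep this window shorter than `δ`.
  set ζ := ((τ.shift t.zero_le ω).min (τ.shift t.zero_le ω₁)).min γ with hζ
  have hE : P.toMeasure (oscEvent ζ δ (c / 4)) ≤ ENNReal.ofReal (ε / (4 * M)) :=
    (measure_mono (oscEvent_mono ζ ((min_le_left _ _).trans (min_le_right _ _)) _)).trans
      (hosc t P hP ζ)
  have hclose : ∀ ω', ω' ∉ oscEvent ζ δ (c / 4) →
      |payoff Y τ t ω γ ω' - payoff Y τ t ω₁ γ ω'| ≤ ε / 2 := by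
    intro ω' hω'
    rw [payoff_apply, payoff_apply]
    set w := concat t.zero_le ω ω' with hw
    set w₁ := concat t.zero_le ω₁ ω' with hw₁
    have hww : ∀ r, ‖w r - w₁ r‖ ≤ min (c / 4) (δ / κ) :=
      norm_concat_sub_concat_left_le t.zero_le ω' hω₁
    have hd : dist w w₁ ≤ δ / κ :=
      Omega.dist_le (by positivity) fun r => (hww r).trans (min_le_right _ _)
    have hττ : |(τ w : ℝ) - τ w₁| ≤ δ := by
      refine (hτ w w₁).trans ((mul_le_mul_of_nonneg_left hd hκ.le).trans_eq ?_)
      field_simp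
    set u := min (τ w) (γ ω') with hu
    set u₁ := min (τ w₁) (γ ω') with hu₁
    have huu : |(u : ℝ) - u₁| ≤ δ := by
      rw [hu, hu₁, min_comm (τ w), min_comm (τ w₁)]
      exact (Time.abs_min_sub_min_le _ _ _).trans hττ
    have hζ' : ζ ω' = max t (min u u₁) := by
      change min (min (max t (τ w)) (max t (τ w₁))) (γ ω') = _
      rw [hu, hu₁, ← max_min_distrib_left, ← inf_inf_distrib_right,
        max_min_distrib_left t (min (τ w) (τ w₁)) (γ ω'), max_eq_right (γ.ge_start ω')]
    refine hYc _ _ _ _ (huu.trans (min_le_right _ _)) fun r => ?_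
    have hmax : ((max u u₁ : Time T) : ℝ) ≤ (min u u₁ : Time T) + δ := by
      rcases le_total u u₁ with h | h
      · rw [max_eq_right h, min_eq_left h]
        linarith [abs_le.mp huu]
      · rw [max_eq_left h, min_eq_right h]
        linarith [abs_le.mp huu]
    have hosc' : ∀ a b : Time T, min u u₁ ≤ a → a ≤ max u u₁ → min u u₁ ≤ b → b ≤ max u u₁ →
        ‖w a - w b‖ ≤ 3 * (c / 4) := by
      intro a b ha ha' hb hb'
      have e1 : ∀ a : Time T, a ≤ max u u₁ → ((max t a : Time T) : ℝ) ≤ ζ ω' + δ := by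
        intro a ha
        have h1 : (a : ℝ) ≤ (max u u₁ : Time T) := ha
        rw [hζ']
        have h2 : ((max t a : Time T) : ℝ) = max (t : ℝ) a := by simp
        have h3 : ((max t (min u u₁) : Time T) : ℝ) = max (t : ℝ) (min u u₁ : Time T) := by simp
        rw [h2, h3]
        refine max_le ?_ ?_
        · linarith [le_max_left (t : ℝ) (min u u₁ : Time T)]
        · linarith [le_max_right (t : ℝ) (min u u₁ : Time T)]
      refine norm_concat_sub_concat_le t.zero_le (δ := δ) (ζ := ζ) (fun r r' h => hω r r'
        (h.trans ((min_le_left _ _).trans (min_le_left _ _)))) hω' ?_ ?_ (e1 a ha') ?_ (e1 b hb')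
      · have h1 : ((min u u₁ : Time T) : ℝ) ≤ a := ha
        have h2 : ((min u u₁ : Time T) : ℝ) ≤ b := hb
        have h3 : (a : ℝ) ≤ (max u u₁ : Time T) := ha'
        have h4 : (b : ℝ) ≤ (max u u₁ : Time T) := hb'
        rw [abs_le]
        constructor <;> linarith
      · rw [hζ']
        exact max_le_max le_rfl ha
      · rw [hζ']
        exact max_le_max le_rfl hb
    have h1 := w.norm_min_sub_min_le (by positivity) hosc' r
    have h2 := (hww (min r u₁)).trans (min_le_left _ _)
    exact (norm_sub_le_norm_sub_add_norm_sub _ (w (min r u₁)) _).trans (by linarith)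
  have hM2 : ε / 2 + 2 * M * (ε / (4 * M)) = ε := by field_simp; ring
  have key := fun f g hf hg hfM hgM h => integral_le_integral_add_of_close P.toMeasure
    (f := f) (g := g) hf hg hM0.le hfM hgM (measurableSet_oscEvent ζ δ (c / 4)) hE
    (half_pos hε).le (show 0 ≤ ε / (4 * M) by positivity) h
  have k1 := key _ _ (hY.measurable_payoff t ω γ) (hY.measurable_payoff t ω₁ γ)
    (abs_payoff_le hM t ω γ) (abs_payoff_le hM t ω₁ γ)
    fun ω' h => by linarith [abs_le.mp (hclose ω' h)]
  have k2 := key _ _ (hY.measurable_payoff t ω₁ γ) (hY.measurable_payoff t ω γ)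
    (abs_payoff_le hM t ω₁ γ) (abs_payoff_le hM t ω γ)
    fun ω' h => by linarith [abs_le.mp (hclose ω' h)]
  rw [hM2] at k1 k2
  rw [abs_le]
  constructor <;> linarith

theorem snell_eq (t : Time T) (ω : Omega d (0 : Time T)) : snell 𝒞 (stopAt Y τ) t ω =
    ⨆ p : 𝒞 t × StopTime d t, ∫ ω', payoff Y τ t ω p.2 ω' ∂p.1.1.toMeasure := rfl

instance (t : Time T) : Nonempty (StopTime d t) := ⟨StopTime.const d le_rfl⟩

/-- A set of full measure has a point, and (P3) turns it into a conditional law in `𝒞 t`. -/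
theorem P3.nonempty (hP3 : P3 𝒞) (hne : (𝒞 0).Nonempty) (t : Time T) : (𝒞 t).Nonempty := by
  rcases t.zero_le.eq_or_lt with h | h
  · rwa [← h]
  · obtain ⟨P, hP⟩ := hne
    obtain ⟨F', hF', P', -, Ω', -, h1, h2⟩ := hP3 0 t h P hP
    have : Ω'.Nonempty := by
      rw [Set.nonempty_iff_ne_empty]
      rintro rfl
      simp at h1
    obtain ⟨ω, hω⟩ := this
    exact ⟨_, h2 hω⟩

/-- The supremum in `ℝ` is meaningful only over a nonempty bounded family: the first comes from
`hne`, the second from `hM`. -/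
theorem abs_snell_le {M : ℝ} (hM : ∀ t ω, |Y t ω| ≤ M) (hne : ∀ t, (𝒞 t).Nonempty) (t : Time T)
    (ω : Omega d (0 : Time T)) : |snell 𝒞 (stopAt Y τ) t ω| ≤ M := by
  have : Nonempty (𝒞 t) := (hne t).to_subtype
  have h1 : ∀ p : 𝒞 t × StopTime d t, |∫ ω', payoff Y τ t ω p.2 ω' ∂p.1.1.toMeasure| ≤ M :=
    fun p => abs_integral_le_of_abs_le _ (abs_payoff_le hM t ω p.2)
  rw [snell_eq, abs_le]
  refine ⟨?_, ciSup_le fun p => (abs_le.mp (h1 p)).2⟩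
  have p : 𝒞 t × StopTime d t := Classical.arbitrary _
  exact (abs_le.mp (h1 p)).1.trans
    (le_ciSup (f := fun p : 𝒞 t × StopTime d t => ∫ ω', payoff Y τ t ω p.2 ω' ∂p.1.1.toMeasure)
      ⟨M, by rintro _ ⟨p, rfl⟩; exact (abs_le.mp (h1 p)).2⟩ p)

theorem InS.le_snell (hY : InS Y τ) {t : Time T} (ω : Omega d (0 : Time T))
    {P : ProbabilityMeasure (Omega d t)} (hP : P ∈ 𝒞 t) (γ : StopTime d t) :
    ∫ ω', payoff Y τ t ω γ ω' ∂P.toMeasure ≤ snell 𝒞 (stopAt Y τ) t ω := by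
  obtain ⟨M, hM0, hM⟩ := hY.bounded
  rw [snell_eq]
  refine le_ciSup (f := fun p : 𝒞 t × StopTime d t =>
    ∫ ω', payoff Y τ t ω p.2 ω' ∂p.1.1.toMeasure) ⟨M, ?_⟩ (⟨P, hP⟩, γ)
  rintro _ ⟨p, rfl⟩
  exact (abs_le.mp (abs_integral_le_of_abs_le _ (abs_payoff_le hM t ω p.2))).2

theorem snell_le (hne : ∀ t, (𝒞 t).Nonempty) {t : Time T} {ω : Omega d (0 : Time T)} {x : ℝ}
    (h : ∀ P ∈ 𝒞 t, ∀ γ : StopTime d t, ∫ ω', payoff Y τ t ω γ ω' ∂P.toMeasure ≤ x) :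
    snell 𝒞 (stopAt Y τ) t ω ≤ x := by
  have : Nonempty (𝒞 t) := (hne t).to_subtype
  rw [snell_eq]
  exact ciSup_le fun p => h _ p.1.2 _

theorem exists_lt_payoff (hne : ∀ t, (𝒞 t).Nonempty) (t : Time T) (ω : Omega d (0 : Time T))
    {x : ℝ} (h : x < snell 𝒞 (stopAt Y τ) t ω) : ∃ P ∈ 𝒞 t, ∃ γ : StopTime d t,
      x < ∫ ω', payoff Y τ t ω γ ω' ∂P.toMeasure := by
  by_contra! h'
  exact absurd (snell_le hne h') (not_le.mpr h)

/-- The radius in `InS.payoff_regular` does not depend on the control, so the estimate survives the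
supremum. -/
theorem InS.snell_regular (hY : InS Y τ) (hP2 : P2 𝒞) (hne : ∀ t, (𝒞 t).Nonempty)
    (ω : Omega d (0 : Time T)) {ε : ℝ}
    (hε : 0 < ε) : ∃ η, 0 < η ∧ ∀ t, ∀ ω₁ : Omega d (0 : Time T),
      (∀ r ≤ t, ‖ω r - ω₁ r‖ ≤ η) →
      |snell 𝒞 (stopAt Y τ) t ω - snell 𝒞 (stopAt Y τ) t ω₁| ≤ ε := by
  obtain ⟨η, hη, h⟩ := hY.payoff_regular hP2 ω hε
  refine ⟨η, hη, fun t ω₁ hω₁ => ?_⟩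
  have h' := h t ω₁ hω₁
  have h1 : snell 𝒞 (stopAt Y τ) t ω ≤ snell 𝒞 (stopAt Y τ) t ω₁ + ε :=
    snell_le hne fun P hP γ => by
      linarith [hY.le_snell ω₁ hP γ, abs_le.mp (h' P hP γ)]
  have h2 : snell 𝒞 (stopAt Y τ) t ω₁ ≤ snell 𝒞 (stopAt Y τ) t ω + ε :=
    snell_le hne fun P hP γ => by
      linarith [hY.le_snell ω hP γ, abs_le.mp (h' P hP γ)]
  rw [abs_le]
  constructor <;> linarith

theorem InS.continuous_snell_right (hY : InS Y τ) (hP2 : P2 𝒞) (hne : ∀ t, (𝒞 t).Nonempty)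
    (t : Time T) : Continuous fun ω => snell 𝒞 (stopAt Y τ) t ω := by
  refine Metric.continuous_iff.mpr fun ω ε hε => ?_
  obtain ⟨η, hη, h⟩ := hY.snell_regular hP2 hne ω (half_pos hε)
  refine ⟨η, hη, fun ω₁ hω₁ => ?_⟩
  rw [dist_comm, Real.dist_eq]
  refine (h t ω₁ fun r _ => ?_).trans_lt (half_lt_self hε)
  rw [dist_comm] at hω₁
  exact (ω.norm_sub_le_dist ω₁ r).trans hω₁.le

theorem InS.continuous_integral_payoff (hY : InS Y τ) (hP2 : P2 𝒞) {t : Time T}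
    {P : ProbabilityMeasure (Omega d t)} (hP : P ∈ 𝒞 t) (γ : StopTime d t) :
    Continuous fun ω => ∫ ω', payoff Y τ t ω γ ω' ∂P.toMeasure := by
  refine Metric.continuous_iff.mpr fun ω ε hε => ?_
  obtain ⟨η, hη, h⟩ := hY.payoff_regular hP2 ω (half_pos hε)
  refine ⟨η, hη, fun ω₁ hω₁ => ?_⟩
  rw [dist_comm, Real.dist_eq]
  refine (h t ω₁ (fun r _ => ?_) P hP γ).trans_lt (half_lt_self hε)
  rw [dist_comm] at hω₁
  exact (ω.norm_sub_le_dist ω₁ r).trans hω₁.le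

theorem snell_congr {t : Time T}
    {ω ω₁ : Omega d (0 : Time T)} (h : ∀ r ≤ t, ω r = ω₁ r) :
    snell 𝒞 (stopAt Y τ) t ω = snell 𝒞 (stopAt Y τ) t ω₁ := by
  simp only [snell, shiftProc, shiftRV, concat_congr t.zero_le _ h]

theorem InS.stopAt_le_snell (hY : InS Y τ) (hne : ∀ t, (𝒞 t).Nonempty) (t : Time T)
    (ω : Omega d (0 : Time T)) : stopAt Y τ t ω ≤ snell 𝒞 (stopAt Y τ) t ω := by
  obtain ⟨P, hP⟩ := hne t
  refine le_trans (le_of_eq ?_) (hY.le_snell ω hP (StopTime.const d le_rfl))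
  have : ∀ ω', payoff Y τ t ω (StopTime.const d le_rfl) ω' = stopAt Y τ t ω := fun ω' =>
    hY.stopAt_congr fun r hr => concat_eval_of_le _ _ _ hr
  simp only [this, integral_const, probReal_univ, one_smul]

/-- At the horizon nothing is left to choose. This makes the contact set nonempty for every path. -/
theorem InS.snell_terminal (hY : InS Y τ) (hne : ∀ t, (𝒞 t).Nonempty) {t : Time T}
    (ht : (t : ℝ) = T) (ω : Omega d (0 : Time T)) :
    snell 𝒞 (stopAt Y τ) t ω = stopAt Y τ t ω := by
  refine le_antisymm (snell_le hne fun P hP γ => le_of_eq ?_) (hY.stopAt_le_snell hne t ω)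
  have : ∀ ω', payoff Y τ t ω γ ω' = stopAt Y τ t ω := fun ω' => by
    rw [payoff_apply, Time.eq_of_coe_eq ht (γ.ge_start ω')]
    exact hY.stopAt_congr fun r hr => concat_eval_of_le _ _ _ hr
  simp only [this, integral_const, probReal_univ, one_smul]

end Regularity

/-! ### Regular conditional laws and conditioning at a fixed time -/

section Conditioning

/-- Disintegration along the regular conditional probability. -/
theorem integral_condExpKernel_diag {Ω : Type*} {m : MeasurableSpace Ω} [mΩ : MeasurableSpace Ω]
    [StandardBorelSpace Ω] (P : Measure Ω) [IsProbabilityMeasure P] (hm : m ≤ mΩ) {g : Ω × Ω → ℝ}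
    (hg : Measurable[m.prod mΩ] g) {M : ℝ} (hM : ∀ p, |g p| ≤ M) :
    StronglyMeasurable[m] (fun ω => ∫ y, g (ω, y) ∂condExpKernel P m ω) ∧
      ∫ ω, g (ω, ω) ∂P = ∫ ω, ∫ y, g (ω, y) ∂condExpKernel P m ω ∂P := by
  have h1 : StronglyMeasurable[m] (fun ω => ∫ y, g (ω, y) ∂condExpKernel P m ω) :=
    hg.stronglyMeasurable.integral_kernel_prod_right'
  refine ⟨h1, ?_⟩
  -- The kernel disintegrates the image of `P` under the diagonal, viewed on `m.prod mΩ`; hence the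
  -- requirement that `g` see its first argument only through `m`.
  rw [integral_trim hm h1, ← Measure.integral_compProd, compProd_trim_condExpKernel hm]
  · have h2 : @Measurable Ω (Ω × Ω) mΩ (m.prod mΩ) Function.diag :=
      @Measurable.prodMk _ mΩ _ _ m mΩ _ _ (measurable_id'' hm) measurable_id
    exact (@integral_map _ _ _ _ mΩ P _ (m.prod mΩ) _ (@Measurable.aemeasurable _ _ mΩ (m.prod mΩ)
      _ _ h2) _ (@StronglyMeasurable.aestronglyMeasurable _ _ _ (m.prod mΩ) (m.prod mΩ) _ _
      (@Measurable.stronglyMeasurable _ _ _ (m.prod mΩ) _ _ _ _ _ hg))).symm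
  · exact .of_bound hg.stronglyMeasurable.aestronglyMeasurable M
      (ae_of_all _ fun p => by simpa using hM p)

/-- The set of paths with admissible conditional law need not be measurable. A measurable superset
contains `Ω'`, and `P'` agrees with `P` on it, so it has full measure. -/
theorem ExtendsToFull.ae_of_subset {Ω : Type} {F : MeasurableSpace Ω} {P : Measure Ω}
    [IsProbabilityMeasure P] {S : Set Ω} (h : ExtendsToFull P S) {A : Set Ω}
    (hA : MeasurableSet A) (hSA : S ⊆ A) : ∀ᵐ ω ∂P, ω ∈ A := by
  obtain ⟨F', hF', P', hP', Ω', hΩ', h1, h2⟩ := h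
  refine (mem_ae_iff_prob_eq_one hA).mpr (le_antisymm prob_le_one ?_)
  rw [← h1, ← hP', trim_measurableSet_eq hF' hA]
  exact measure_mono (h2.trans hSA)

variable {d : ℕ} {T : ℝ}

theorem stopPath_eq_of_le {t r u : Time T} (h : u ≤ r) (ω : Omega d t) : stopPath r ω u = ω u := by
  rw [stopPath_eval, min_eq_left h]

/-- By `hs` the first argument may be replaced by its path stopped at `s`, which makes the integrand
measurable for the past in that argument, so the kernel disintegration applies. -/
theorem integral_shiftProb {t : Time T} (P : ProbabilityMeasure (Omega d t)) (s : Time T)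
    {h : Omega d t → Omega d s → ℝ} (hm : Measurable fun p : Omega d t × Omega d s => h p.1 p.2)
    (hs : ∀ ω ω₁ ω', (∀ r ≤ s, ω r = ω₁ r) → h ω ω' = h ω₁ ω') {M : ℝ}
    (hM : ∀ ω ω', |h ω ω'| ≤ M) :
    Measurable (fun ω => ∫ ω', h ω ω' ∂(shiftProb P s ω).toMeasure) ∧
      ∫ ω, h ω (trunc s ω) ∂P.toMeasure =
        ∫ ω, ∫ ω', h ω ω' ∂(shiftProb P s ω).toMeasure ∂P.toMeasure := by
  have h1 : ∀ ω ω', h (stopPath s ω) ω' = h ω ω' := fun ω ω' =>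
    hs _ _ _ fun r hr => stopPath_eq_of_le hr ω
  have hg : Measurable[(filt d t s).prod inferInstance]
      fun p : Omega d t × Omega d t => h p.1 (trunc s p.2) := by
    have : (fun p : Omega d t × Omega d t => h p.1 (trunc s p.2)) =
        (fun p : Omega d t × Omega d s => h p.1 p.2) ∘
          fun p : Omega d t × Omega d t => (stopPath s p.1, trunc s p.2) := by
      funext p
      exact (h1 _ _).symm
    rw [this]
    refine hm.comp (Measurable.prodMk ?_ ?_)
    · exact (measurable_stopPath s).comp measurable_fst
    · exact (measurable_trunc s).comp (@measurable_snd _ _ (filt d t s) _)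
  have h2 : ∀ ω, ∫ ω', h ω ω' ∂(shiftProb P s ω).toMeasure =
      ∫ y, h ω (trunc s y) ∂condExpKernel P.toMeasure (filt d t s) ω := fun ω => by
    change ∫ ω', h ω ω' ∂((condExpKernel P.toMeasure (filt d t s) ω).map (trunc s)) = _
    rw [integral_map (measurable_trunc s).aemeasurable]
    exact (hm.comp (measurable_const.prodMk measurable_id)).aestronglyMeasurable
  obtain ⟨a, b⟩ := integral_condExpKernel_diag P.toMeasure ((filt d t).le s) hg
    (M := M) (fun p => hM _ _)
  simp only [h2]
  exact ⟨(a.mono ((filt d t).le s)).measurable, b⟩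

theorem integrable_of_bounded {Ω : Type*} [MeasurableSpace Ω] {P : Measure Ω}
    [IsFiniteMeasure P] {f : Ω → ℝ} (hf : Measurable f) {M : ℝ} (hM : ∀ ω, |f ω| ≤ M) :
    Integrable f P :=
  .of_bound hf.aestronglyMeasurable M (ae_of_all _ fun ω => by simpa using hM ω)

variable [Fact (0 < T)] {Y : Time T → Omega d (0 : Time T) → ℝ} {τ : StopTime d (0 : Time T)}
  {𝒞 : ∀ t : Time T, Set (ProbabilityMeasure (Omega d t))}

/-- If the conditional expected values are dominated whenever the conditional law is admissible,
then so is the expected value. -/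
theorem P3.integral_le (hP3 : P3 𝒞) {t s : Time T} (hts : t < s)
    {P : ProbabilityMeasure (Omega d t)} (hP : P ∈ 𝒞 t)
    {h : Omega d t → Omega d s → ℝ} (hm : Measurable fun p : Omega d t × Omega d s => h p.1 p.2)
    (hs : ∀ ω ω₁ ω', (∀ r ≤ s, ω r = ω₁ r) → h ω ω' = h ω₁ ω') {M : ℝ}
    (hM : ∀ ω ω', |h ω ω'| ≤ M) {g : Omega d t → ℝ} (hg : Measurable g) (hgM : ∀ ω, |g ω| ≤ M)
    (hle : ∀ ω, ∀ Q ∈ 𝒞 s, ∫ ω', h ω ω' ∂Q.toMeasure ≤ g ω) :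
    ∫ ω, h ω (trunc s ω) ∂P.toMeasure ≤ ∫ ω, g ω ∂P.toMeasure := by
  obtain ⟨h1, h2⟩ := integral_shiftProb P s hm hs hM
  rw [h2]
  refine integral_mono_ae (integrable_of_bounded h1 fun ω => abs_integral_le_of_abs_le _ (hM ω))
    (integrable_of_bounded hg hgM) ?_
  -- The measurable superset is the set where the conditional inequality holds.
  exact (hP3 t s hts P hP).ae_of_subset (measurableSet_le h1 hg) fun ω hω => hle ω _ hω

/-- Conditioning at a deterministic time: late stopping is dominated by the Snell envelope. -/
theorem InS.integral_payoff_le (hY : InS Y τ) (hP2 : P2 𝒞) (hP3 : P3 𝒞)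
    (hne : ∀ t, (𝒞 t).Nonempty) {t s : Time T} (hts : t < s) (ω : Omega d (0 : Time T))
    {P : ProbabilityMeasure (Omega d t)} (hP : P ∈ 𝒞 t) {γ : StopTime d t}
    (hγ : ∀ ω', s ≤ γ ω') :
    ∫ ω', payoff Y τ t ω γ ω' ∂P.toMeasure ≤
      ∫ ω', snell 𝒞 (stopAt Y τ) s (concat t.zero_le ω ω') ∂P.toMeasure := by
  obtain ⟨M, hM0, hM⟩ := hY.bounded
  have h1 := hP3.integral_le hts hP
    (h := fun ω' ω'' => payoff Y τ t ω γ (concat hts.le ω' ω''))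
    ((hY.measurable_payoff t ω γ).comp (continuous_concat hts.le).measurable)
    (fun ω' ω₁ ω'' h => by rw [concat_congr hts.le ω'' h])
    (fun _ _ => abs_payoff_le hM t ω γ _)
    (g := fun ω' => snell 𝒞 (stopAt Y τ) s (concat t.zero_le ω ω'))
    ((hY.continuous_snell_right hP2 hne s).comp (continuous_concat_right t.zero_le ω)).measurable
    (fun _ => abs_snell_le hM hne _ _)
    (fun ω' Q hQ => by
      refine le_trans (le_of_eq ?_) (hY.le_snell (concat t.zero_le ω ω') hQ (γ.shift hts.le ω'))
      congr 1
      funext ω''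
      rw [payoff_apply, payoff_apply, concat_assoc t.zero_le hts.le]
      congr 1
      -- The truncation at `s` in the shifted stopping time is inactive because `γ` never stops
      -- before `s`.
      exact (max_eq_right (hγ _)).symm)
  simpa only [concat_trunc] using h1

end Conditioning

/-! ### Pasting of controls and the supermartingale inequality -/

section Pasting

variable {d : ℕ} {T : ℝ}

/-- The distance up to `s` is thus a genuine distance of stopped paths, so its balls are events of
the filtration at `s` and neighbourhoods of their centres. -/
theorem distUpTo_eq_dist_stopPath {t s : Time T} (hts : t ≤ s) (ω ω' : Omega d t) :
    distUpTo s ω ω' = dist (stopPath s ω) (stopPath s ω') := by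
  have hb : ∀ r : Set.Icc t s, ‖ω (r : Time T) - ω' (r : Time T)‖ ≤
      dist (stopPath s ω) (stopPath s ω') := fun r => by
    rw [← stopPath_eq_of_le r.2.2 ω, ← stopPath_eq_of_le r.2.2 ω']
    exact Omega.norm_sub_le_dist _ _ _
  have : Nonempty (Set.Icc t s) := ⟨⟨t, le_rfl, hts⟩⟩
  refine le_antisymm (ciSup_le hb)
    (Omega.dist_le (Real.iSup_nonneg fun _ => norm_nonneg _) fun r => ?_)
  rw [stopPath_eval, stopPath_eval, ← ω.eval_max, ← ω'.eval_max]
  exact le_ciSup (f := fun r : Set.Icc t s => ‖ω (r : Time T) - ω' (r : Time T)‖)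
    ⟨_, by rintro _ ⟨r, rfl⟩; exact hb r⟩ ⟨max t (min r s), le_max_left _ _,
      max_le hts (min_le_right _ _)⟩

theorem norm_sub_le_of_mem_ballUpTo {t s : Time T} (hts : t ≤ s) {δ : ℝ} {ω ω' : Omega d t}
    (h : ω' ∈ ballUpTo s δ ω) {r : Time T} (hr : r ≤ s) : ‖ω r - ω' r‖ ≤ δ := by
  have h1 : distUpTo s ω' ω < δ := h
  rw [distUpTo_eq_dist_stopPath hts] at h1
  rw [← stopPath_eq_of_le hr ω, ← stopPath_eq_of_le hr ω', norm_sub_rev]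
  exact (Omega.norm_sub_le_dist _ _ _).trans h1.le

theorem measurableSet_ballUpTo {t s : Time T} (hts : t ≤ s) (δ : ℝ) (ω : Omega d t) :
    MeasurableSet[filt d t s] (ballUpTo s δ ω) := by
  have : ballUpTo s δ ω = stopPath s ⁻¹' Metric.ball (stopPath s ω) δ := by
    ext ω'
    change distUpTo s ω' ω < δ ↔ _
    rw [distUpTo_eq_dist_stopPath hts]
    rfl
  rw [this]
  exact measurable_stopPath s Metric.isOpen_ball.measurableSet

theorem ballUpTo_mem_nhds {t s : Time T} (hts : t ≤ s) {δ : ℝ} (hδ : 0 < δ) (ω : Omega d t) :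
    ballUpTo s δ ω ∈ 𝓝 ω := by
  refine Filter.mem_of_superset (Metric.ball_mem_nhds ω hδ) fun ω' hω' => ?_
  change distUpTo s ω' ω < δ
  rw [distUpTo_eq_dist_stopPath hts]
  refine lt_of_le_of_lt (Omega.dist_le dist_nonneg fun r => ?_) hω'
  rw [stopPath_eval, stopPath_eval]
  exact Omega.norm_sub_le_dist _ _ _

instance (t : Time T) : Nonempty (Omega d t) := ⟨⟨0, rfl⟩⟩

/-- The stopping time that follows `γ k ∘ Π_s` on the event `J = k`, `k ≤ n`, and is `u`
elsewhere. -/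
def StopTime.paste {t s : Time T} (hts : t ≤ s) (J : Omega d t → ℕ)
    (hJ : Measurable[filt d t s] J) (γ : ℕ → StopTime d s) (n : ℕ) (u : Time T) (hu : s ≤ u) :
    StopTime d t :=
  StopTime.mk' (fun ω => if J ω ≤ n then γ (J ω) (trunc s ω) else u)
    (fun ω => by
      split_ifs
      · exact hts.trans ((γ _).ge_start _)
      · exact hts.trans hu)
    (by
      have hJ' : Measurable J := hJ.mono ((filt d t).le s) le_rfl
      have h1 : Measurable fun p : Omega d t × ℕ => γ p.2 (trunc s p.1) :=
        measurable_from_prod_countable_left fun n => (γ n).measurable.comp (measurable_trunc s)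
      exact Measurable.ite (hJ' measurableSet_Iic) (h1.comp (measurable_id.prodMk hJ'))
        measurable_const)
    fun ω ω' h => by
      have hs : s ≤ if J ω ≤ n then γ (J ω) (trunc s ω) else u := by
        split_ifs
        · exact (γ _).ge_start _
        · exact hu
      -- The pasted time never stops before `s`, so paths agreeing up to it agree up to `s`, where
      -- `J` is already known.
      have hJJ : J ω' = J ω := (measurableSet_filt_iff.mp
        (hJ (measurableSet_singleton (J ω)))).2 ω ω' (fun r hr => h r (hr.trans hs)) rfl
      simp only [hJJ]
      split_ifs with h1
      · simp only [if_pos h1] at h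
        refine ((γ (J ω)).congr (r := γ (J ω) (trunc s ω)) (fun r hr => ?_) le_rfl).le
        rcases le_total s r with h2 | h2
        · rw [trunc_eval _ h2, trunc_eval _ h2, h r hr, h s (h2.trans hr)]
        · rw [Omega.eval_of_le _ h2, Omega.eval_of_le _ h2]
      · exact le_rfl

theorem StopTime.paste_apply_of_le {t s : Time T} {hts : t ≤ s} {J : Omega d t → ℕ}
    {hJ : Measurable[filt d t s] J} {γ : ℕ → StopTime d s} {n : ℕ} {u : Time T} {hu : s ≤ u}
    {ω : Omega d t} {k : ℕ} (h : J ω = k) (hk : k ≤ n) :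
    StopTime.paste hts J hJ γ n u hu ω = γ k (trunc s ω) := by
  subst h
  exact if_pos hk

/-- Taking the least index makes the cover disjoint without leaving the filtration at `s`. -/
theorem exists_measurable_index {t s : Time T} {O : ℕ → Set (Omega d t)}
    (hO : ∀ k, MeasurableSet[filt d t s] (O k)) (hc : ∀ ω, ∃ k, ω ∈ O k) :
    ∃ J : Omega d t → ℕ, Measurable[filt d t s] J ∧ ∀ ω, ω ∈ O (J ω) := by
  classical
  exact ⟨fun ω => Nat.find (hc ω), measurable_find hc hO, fun ω => Nat.find_spec (hc ω)⟩

theorem exists_real_lt_of_nat {Ω : Type*} [MeasurableSpace Ω] (P : Measure Ω)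
    [IsProbabilityMeasure P] {J : Ω → ℕ} (hJ : Measurable J) {ε : ℝ} (hε : 0 < ε) :
    ∃ n, P.real {ω | n < J ω} < ε := by
  have h1 : Tendsto (fun n => P {ω | n < J ω}) atTop (𝓝 0) := by
    have h2 : ⋂ n : ℕ, {ω | n < J ω} = ∅ := by
      ext ω
      simp only [Set.mem_iInter, Set.mem_ofPred_eq, Set.mem_empty_iff_false, iff_false, not_forall]
      exact ⟨J ω, lt_irrefl _⟩
    rw [← measure_empty (μ := P), ← h2]
    exact tendsto_measure_iInter_atTop (fun n => (hJ measurableSet_Ioi).nullMeasurableSet)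
      (fun m n hmn ω hω => lt_of_le_of_lt hmn hω) ⟨0, measure_ne_top _ _⟩
  have h3 := (ENNReal.tendsto_toReal ENNReal.zero_ne_top).comp h1
  exact (h3.eventually_lt_const hε).exists

variable [Fact (0 < T)] {Y : Time T → Omega d (0 : Time T) → ℝ} {τ : StopTime d (0 : Time T)}
  {𝒞 : ∀ t : Time T, Set (ProbabilityMeasure (Omega d t))}

/-- Near-optimal controls, locally uniformly in the past path. -/
theorem InS.exists_near_optimal (hY : InS Y τ) (hP2 : P2 𝒞) (hne : ∀ t, (𝒞 t).Nonempty)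
    (s : Time T) (ω : Omega d (0 : Time T)) {ε : ℝ} (hε : 0 < ε) :
    ∃ η, 0 < η ∧ ∃ Q ∈ 𝒞 s, ∃ γ : StopTime d s, ∀ ω₁ : Omega d (0 : Time T),
      (∀ r ≤ s, ‖ω r - ω₁ r‖ ≤ η) →
        snell 𝒞 (stopAt Y τ) s ω₁ - ε ≤ ∫ ω', payoff Y τ s ω₁ γ ω' ∂Q.toMeasure := by
  have hε3 : 0 < ε / 3 := by positivity
  obtain ⟨η, hη, h⟩ := hY.payoff_regular hP2 ω hε3
  obtain ⟨η', hη', h'⟩ := hY.snell_regular hP2 hne ω hε3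
  obtain ⟨Q, hQ, γ, hγ⟩ := exists_lt_payoff (Y := Y) (τ := τ) hne s ω (sub_lt_self _ hε3)
  refine ⟨min η η', by positivity, Q, hQ, γ, fun ω₁ hω₁ => ?_⟩
  have h1 := abs_le.mp (h s ω₁ (fun r hr => (hω₁ r hr).trans (min_le_left _ _)) Q hQ γ)
  have h2 := abs_le.mp (h' s ω₁ (fun r hr => (hω₁ r hr).trans (min_le_right _ _)))
  linarith

/-- The Snell envelope is a supermartingale: the pasting argument. -/
theorem InS.integral_snell_le (hY : InS Y τ) (hP2 : P2 𝒞) (hP4 : P4 𝒞)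
    (hne : ∀ t, (𝒞 t).Nonempty) {t s : Time T} (hts : t < s) (ω : Omega d (0 : Time T))
    {P : ProbabilityMeasure (Omega d t)} (hP : P ∈ 𝒞 t) :
    ∫ ω', snell 𝒞 (stopAt Y τ) s (concat t.zero_le ω ω') ∂P.toMeasure ≤
      snell 𝒞 (stopAt Y τ) t ω := by
  obtain ⟨M, hM0, hM⟩ := hY.bounded
  set V : Omega d t → ℝ := fun ω' => snell 𝒞 (stopAt Y τ) s (concat t.zero_le ω ω') with hV
  have hVm : Measurable V :=
    ((hY.continuous_snell_right hP2 hne s).comp (continuous_concat_right t.zero_le ω)).measurable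
  have hVM : ∀ ω', |V ω'| ≤ M := fun ω' => abs_snell_le hM hne _ _
  -- One `ε` pays for near-optimality, one for the pasting error `ρ δ`, and `2 * M * ε` for the
  -- cells left out.
  have main : ∀ ε : ℝ, 0 < ε → ∫ ω', V ω' ∂P.toMeasure ≤
      snell 𝒞 (stopAt Y τ) t ω + (2 + 2 * M) * ε := by
    intro ε hε
    obtain ⟨ρ, hρ, hpaste⟩ := hP4 Y τ hY
    obtain ⟨δ₀, hδ₀, hρδ⟩ := hρ.exists_le hε
    obtain ⟨δ, hδ, hδδ₀⟩ := exists_rat_btwn hδ₀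
    have hδ' : 0 < δ := by exact_mod_cast hδ
    -- Each past has a ball of rational radius at most `δ` on which one control is near-optimal;
    -- second countability then extracts countably many balls.
    have hex : ∀ ω₀ : Omega d t, ∃ δ' : ℚ, 0 < δ' ∧ δ' ≤ δ ∧ ∃ Q ∈ 𝒞 s, ∃ γ : StopTime d s,
        ∀ ω' ∈ ballUpTo s δ' ω₀,
          V ω' - ε ≤ ∫ ω'', payoff Y τ s (concat t.zero_le ω ω') γ ω'' ∂Q.toMeasure := by
      intro ω₀
      obtain ⟨η, hη, Q, hQ, γ, h⟩ :=
        hY.exists_near_optimal hP2 hne s (concat t.zero_le ω ω₀) hε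
      obtain ⟨q, hq, hq'⟩ := exists_rat_btwn (lt_min hη hδ)
      refine ⟨q, by exact_mod_cast hq, by exact_mod_cast (hq'.trans_le (min_le_right _ _)).le,
        Q, hQ, γ, fun ω' hω' => h _ fun r hr => ?_⟩
      rw [concat_eval, concat_eval, add_sub_add_left_eq_sub]
      exact (norm_sub_le_of_mem_ballUpTo hts.le hω' hr).trans
        (hq'.trans_le (min_le_left _ _)).le
    choose δ' hδ'0 hδ'δ Q hQ γ hopt using hex
    obtain ⟨S, hS, hSU⟩ := TopologicalSpace.countable_cover_nhds fun ω₀ : Omega d t =>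
      ballUpTo_mem_nhds hts.le (show (0 : ℝ) < δ' ω₀ by exact_mod_cast hδ'0 ω₀) ω₀
    have hSne : S.Nonempty := by
      by_contra h
      rw [Set.not_nonempty_iff_eq_empty] at h
      rw [h] at hSU
      have : (Set.univ : Set (Omega d t)).Nonempty := Set.univ_nonempty
      rw [← hSU] at this
      simp at this
    obtain ⟨x, rfl⟩ := hS.exists_eq_range hSne
    have hcov : ∀ ω', ∃ k, ω' ∈ ballUpTo s (δ' (x k)) (x k) := by
      intro ω'
      have : ω' ∈ ⋃ ω₀ ∈ Set.range x, ballUpTo s (δ' ω₀) ω₀ := by rw [hSU]; trivial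
      simpa using this
    obtain ⟨J, hJ, hJmem⟩ := exists_measurable_index
      (fun k => measurableSet_ballUpTo hts.le (δ' (x k) : ℝ) (x k)) hcov
    have hJ' : Measurable J := hJ.mono ((filt d t).le s) le_rfl
    obtain ⟨n, hn⟩ := exists_real_lt_of_nat P.toMeasure hJ' hε
    -- Cell 0 gathers the tail of the cover, of probability below `ε`, where the pasted law keeps
    -- `P`; cell `k + 1` is the event `J = k`.
    let A : Fin (n + 1 + 1) → Set (Omega d t) :=
      Fin.cons {ω' | n < J ω'} fun k : Fin (n + 1) => {ω' | J ω' = k}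
    have hA0 : A 0 = {ω' | n < J ω'} := rfl
    have hAs : ∀ k : Fin (n + 1), A k.succ = {ω' | J ω' = k} := fun k => rfl
    have hAm : ∀ k, MeasurableSet[filt d t s] (A k) := by
      refine Fin.cases ?_ fun k => ?_
      · exact hJ measurableSet_Ioi
      · exact hJ (measurableSet_singleton (k : ℕ))
    have hAm' : ∀ k, MeasurableSet (A k) := fun k => (filt d t).le s _ (hAm k)
    have hAd : Pairwise (Function.onFun Disjoint A) := by
      have h0 : ∀ k : Fin (n + 1), Disjoint (A 0) (A k.succ) := fun k =>
        Set.disjoint_left.mpr fun ω' h1 h2 => by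
          rw [hA0] at h1
          rw [hAs] at h2
          simp only [Set.mem_ofPred_eq] at h1 h2
          omega
      intro i j
      refine Fin.cases ?_ (fun i => ?_) i <;> refine Fin.cases ?_ (fun j => ?_) j
      · exact fun h => absurd rfl h
      · exact fun _ => h0 j
      · exact fun _ => (h0 i).symm
      · intro hij
        refine Set.disjoint_left.mpr fun ω' h1 h2 => hij ?_
        rw [hAs] at h1 h2
        exact congrArg Fin.succ (Fin.ext (h1.symm.trans h2))
    have hAU : ⋃ k, A k = Set.univ := by
      refine Set.eq_univ_of_forall fun ω' => Set.mem_iUnion.mpr ?_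
      rcases lt_or_ge n (J ω') with h | h
      · exact ⟨0, h⟩
      · exact ⟨Fin.succ ⟨J ω', Nat.lt_succ_of_le h⟩, rfl⟩
    obtain ⟨P', hP', h0, hj⟩ := hpaste t s hts ω P hP δ hδ' (n + 1) (Nat.succ_pos n) A hAm hAd hAU
      (fun k => ⟨δ' (x k), hδ'0 _, hδ'δ _, x k, fun ω' hω' => by
        have h1 : J ω' = k := hω'
        rw [← h1]
        exact hJmem ω'⟩)
      (fun k => Q (x k)) (fun k => hQ _)
    set γ' : StopTime d t := StopTime.paste hts.le J hJ (fun k => γ (x k)) n s le_rfl with hγ'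
    -- The comparison integrand: on cell 0 it is at most `-M`, below any payoff; on the others it is
    -- below the near-optimal value minus the pasting error. The integrals under the two laws can
    -- thus be compared cell by cell.
    set F : Omega d t → ℝ := fun ω' => V ω' - 2 * ε - (A 0).indicator (fun _ => 2 * M) ω' with hF
    have hind : Integrable ((A 0).indicator fun _ : Omega d t => 2 * M) P.toMeasure :=
      (integrable_const _).indicator (hAm' 0)
    have hVi : Integrable V P.toMeasure := integrable_of_bounded hVm hVM
    have hFi : Integrable F P.toMeasure := (hVi.sub (integrable_const _)).sub hind
    have hpi : Integrable (payoff Y τ t ω γ') P'.toMeasure :=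
      integrable_of_bounded (hY.measurable_payoff t ω γ') (abs_payoff_le hM t ω γ')
    have hcell : ∀ k, ∫ ω' in A k, F ω' ∂P.toMeasure ≤
        ∫ ω' in A k, payoff Y τ t ω γ' ω' ∂P'.toMeasure := by
      refine Fin.cases ?_ fun k => ?_
      · have e1 : P'.toMeasure.real (A 0) = P.toMeasure.real (A 0) := by
          have := h0 Set.univ MeasurableSet.univ
          rw [Set.univ_inter] at this
          rw [Measure.real, Measure.real, this]
        have e2 : ∫ ω' in A 0, F ω' ∂P.toMeasure ≤ ∫ ω' in A 0, (-M) ∂P.toMeasure := by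
          refine setIntegral_mono_on hFi.integrableOn (integrable_const _) (hAm' 0)
            fun ω' hω' => ?_
          simp only [hF, Set.indicator_of_mem hω']
          linarith [abs_le.mp (hVM ω')]
        have e3 : ∫ ω' in A 0, (-M) ∂P'.toMeasure ≤
            ∫ ω' in A 0, payoff Y τ t ω γ' ω' ∂P'.toMeasure :=
          setIntegral_mono_on (integrable_const _) hpi.integrableOn (hAm' 0)
            fun ω' _ => (abs_le.mp (abs_payoff_le hM t ω γ' ω')).1
        rw [setIntegral_const] at e2 e3
        rw [e1] at e3
        exact e2.trans e3
      · have e1 := (hj k Set.univ MeasurableSet.univ).2 (γ (x k))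
        rw [Set.univ_inter] at e1
        have e2 : ∫ ω' in A k.succ, payoff Y τ t ω γ' ω' ∂P'.toMeasure =
            ∫ ω' in A k.succ, shiftProc (stopAt Y τ) t ω (γ (x k) (trunc s ω')) ω'
              ∂P'.toMeasure := by
          refine setIntegral_congr_fun (hAm' _) fun ω' hω' => ?_
          change shiftProc (stopAt Y τ) t ω (γ' ω') ω' = _
          rw [hγ', StopTime.paste_apply_of_le (k := k) hω' (Nat.le_of_lt_succ k.2)]
        rw [e2]
        refine le_trans ?_ e1
        refine setIntegral_mono_on hFi.integrableOn ?_ (hAm' _) fun ω' hω' => ?_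
        · refine Integrable.integrableOn (Integrable.sub ?_ (integrable_const _))
          exact integrable_of_bounded (M := M)
            ((hY.continuous_integral_payoff hP2 (hQ (x k)) (γ (x k))).comp
              (continuous_concat_right t.zero_le ω)).measurable
            fun ω' => abs_integral_le_of_abs_le _ (abs_payoff_le hM _ _ _)
        · have h1 : J ω' = k := hω'
          have h2 := hopt (x k) ω' (by rw [← h1]; exact hJmem ω')
          have h3 := hρδ δ hδ.le hδδ₀.le
          have h4 : 0 ≤ (A 0).indicator (fun _ : Omega d t => 2 * M) ω' :=
            Set.indicator_nonneg (fun _ _ => by positivity) _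
          simp only [hF]
          change _ ≤ ∫ ω'', payoff Y τ s (concat t.zero_le ω ω') (γ (x k)) ω''
            ∂(Q (x k)).toMeasure - ρ δ
          linarith
    have hsum : ∫ ω', F ω' ∂P.toMeasure ≤ ∫ ω', payoff Y τ t ω γ' ω' ∂P'.toMeasure := by
      rw [← setIntegral_univ, ← setIntegral_univ (μ := P'.toMeasure), ← hAU,
        integral_iUnion_fintype hAm' hAd fun _ => hFi.integrableOn,
        integral_iUnion_fintype hAm' hAd fun _ => hpi.integrableOn]
      exact Finset.sum_le_sum fun k _ => hcell k
    have hFint : ∫ ω', F ω' ∂P.toMeasure =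
        ∫ ω', V ω' ∂P.toMeasure - 2 * ε - P.toMeasure.real (A 0) * (2 * M) := by
      rw [hF, integral_sub (by exact hVi.sub (integrable_const _)) hind,
        integral_sub hVi (integrable_const _), integral_const, integral_indicator_const _ (hAm' 0)]
      simp
    have h5 := hY.le_snell ω hP' γ'
    have h6 : P.toMeasure.real (A 0) < ε := hn
    nlinarith
  refine le_of_forall_pos_le_add fun ε hε => ?_
  have := main (ε / (2 + 2 * M)) (by positivity)
  rwa [mul_div_cancel₀ _ (by positivity)] at this

end Pasting

/-! ### Joint continuity of the Snell envelope -/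

section SnellContinuity

variable {d : ℕ} {T : ℝ} [Fact (0 < T)] {Y : Time T → Omega d (0 : Time T) → ℝ}
  {τ : StopTime d (0 : Time T)} {𝒞 : ∀ t : Time T, Set (ProbabilityMeasure (Omega d t))}

/-- Between `t` and `s` most paths barely move, so Z at `s` along the concatenation is close to its
value along `ω`. The supermartingale inequality bounds Z at `s` by Z at `t`; for the converse,
delaying each stopping time to at least `s` changes the payoff little, and the delayed payoff is
dominated by conditioning. -/
theorem InS.snell_time_regular (hY : InS Y τ) (hP2 : P2 𝒞) (hP3 : P3 𝒞) (hP4 : P4 𝒞)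
    (hne : ∀ t, (𝒞 t).Nonempty) (ω : Omega d (0 : Time T)) {ε : ℝ} (hε : 0 < ε) :
    ∃ h, 0 < h ∧ ∀ t s : Time T, t ≤ s → (s : ℝ) - t ≤ h →
      |snell 𝒞 (stopAt Y τ) t ω - snell 𝒞 (stopAt Y τ) s ω| ≤ ε := by
  obtain ⟨M, hM0, hM⟩ := hY.bounded
  have hε4 : 0 < ε / 4 := by positivity
  obtain ⟨η, hη, hZ⟩ := hY.snell_regular hP2 hne ω hε4
  obtain ⟨c, hc, hYc⟩ := hY.exists_le hε4
  -- Off the bad event the concatenated path moves by at most `3 * c' ≤ c`, and with the modulus of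
  -- `ω` it stays within `4 * c' ≤ η` of `ω`.
  set c' := min η c / 4 with hc'
  have hc'0 : 0 < c' := by positivity
  have hc'η : 4 * c' ≤ η := by linarith [min_le_left η c]
  have hc'c : 4 * c' ≤ c := by linarith [min_le_right η c]
  obtain ⟨δ₁, hδ₁, hω⟩ := ω.exists_modulus hc'0
  obtain ⟨δ₂, hδ₂, hosc⟩ := hP2.exists_oscEvent_le hc'0 (show 0 < ε / (8 * M) by positivity)
  set h := min (min δ₁ δ₂) c with hh
  have hhδ₁ : h ≤ δ₁ := (min_le_left _ _).trans (min_le_left _ _)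
  have hhδ₂ : h ≤ δ₂ := (min_le_left _ _).trans (min_le_right _ _)
  have hhc : h ≤ c := min_le_right _ _
  refine ⟨h, by positivity, fun t s hts hst => ?_⟩
  rcases hts.eq_or_lt with rfl | hts'
  · simpa using hε.le
  set ζ : StopTime d t := StopTime.const d le_rfl with hζ
  have hζt : ∀ ω', ζ ω' = t := fun _ => rfl
  set E := oscEvent ζ h c' with hE
  have hPE : ∀ P ∈ 𝒞 t, P.toMeasure E ≤ ENNReal.ofReal (ε / (8 * M)) := fun P hP =>
    (measure_mono (oscEvent_mono ζ hhδ₂ _)).trans (hosc t P hP ζ)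
  have hw : ∀ ω' ∉ E, ∀ a b : Time T, t ≤ a → a ≤ s → t ≤ b → b ≤ s →
      ‖concat t.zero_le ω ω' a - concat t.zero_le ω ω' b‖ ≤ 3 * c' := by
    intro ω' hω' a b ha ha' hb hb'
    have e1 : (t : ℝ) ≤ a := ha
    have e2 : (a : ℝ) ≤ s := ha'
    have e3 : (t : ℝ) ≤ b := hb
    have e4 : (b : ℝ) ≤ s := hb'
    refine norm_concat_sub_concat_le t.zero_le (δ := h) (ζ := ζ)
      (fun r r' hr => hω r r' (hr.trans hhδ₁)) hω' ?_ (le_max_left _ _) ?_ (le_max_left _ _) ?_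
    · rw [abs_le]
      constructor <;> linarith
    · rw [max_eq_right ha, hζt]
      linarith
    · rw [max_eq_right hb, hζt]
      linarith
  have hww : ∀ ω' ∉ E, ∀ r ≤ s, ‖ω r - concat t.zero_le ω ω' r‖ ≤ η := by
    intro ω' hω' r hr
    rcases le_total r t with hrt | hrt
    · rw [concat_eval_of_le _ _ _ hrt, sub_self, norm_zero]
      exact hη.le
    · have e1 := hw ω' hω' t r le_rfl hts hrt hr
      rw [concat_eval_of_le _ _ _ le_rfl] at e1
      have e2 := hω r t (by
        have e1 : (t : ℝ) ≤ r := hrt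
        have e2 : (r : ℝ) ≤ s := hr
        rw [abs_of_nonneg (by linarith)]
        linarith)
      exact (norm_sub_le_norm_sub_add_norm_sub _ (ω t) _).trans (by linarith)
  set V : Omega d t → ℝ := fun ω' => snell 𝒞 (stopAt Y τ) s (concat t.zero_le ω ω') with hV
  have hVm : Measurable V :=
    ((hY.continuous_snell_right hP2 hne s).comp (continuous_concat_right t.zero_le ω)).measurable
  have hVM : ∀ ω', |V ω'| ≤ M := fun ω' => abs_snell_le hM hne _ _
  have hsM : |snell 𝒞 (stopAt Y τ) s ω| ≤ M := abs_snell_le hM hne _ _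
  have hVZ : ∀ ω' ∉ E, |snell 𝒞 (stopAt Y τ) s ω - V ω'| ≤ ε / 4 := fun ω' hω' =>
    hZ s _ (hww ω' hω')
  have hM2 : ε / 4 + 2 * M * (ε / (8 * M)) = ε / 2 := by field_simp; ring
  have key := fun (P : ProbabilityMeasure (Omega d t)) (hP : P ∈ 𝒞 t) f g hf hg hfM hgM h =>
    integral_le_integral_add_of_close P.toMeasure
      (f := f) (g := g) hf hg hM0.le hfM hgM (measurableSet_oscEvent ζ _ _) (hPE P hP)
      hε4.le (show 0 ≤ ε / (8 * M) by positivity) h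
  simp only [hM2] at key
  rw [abs_le]
  constructor
  · obtain ⟨P, hP⟩ := hne t
    have k1 := key P hP (fun _ => snell 𝒞 (stopAt Y τ) s ω) V measurable_const hVm
      (fun _ => hsM) hVM fun ω' hω' => by linarith [abs_le.mp (hVZ ω' hω')]
    have k2 := hY.integral_snell_le hP2 hP4 hne hts' ω hP
    simp only [integral_const, probReal_univ, one_smul] at k1
    linarith
  · rw [sub_le_iff_le_add]
    refine snell_le hne fun P hP γ => ?_
    set γ' := γ.max (StopTime.const d hts) with hγ'
    have hγ's : ∀ ω', γ' ω' = max (γ ω') s := fun _ => rfl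
    have k1 := key P hP V (fun _ => snell 𝒞 (stopAt Y τ) s ω) hVm measurable_const hVM
      (fun _ => hsM) fun ω' hω' => by linarith [abs_le.mp (hVZ ω' hω')]
    have k2 := hY.integral_payoff_le hP2 hP3 hne hts' ω hP (γ := γ') fun ω' => le_max_right _ _
    have k3 := key P hP (payoff Y τ t ω γ) (payoff Y τ t ω γ') (hY.measurable_payoff t ω γ)
      (hY.measurable_payoff t ω γ') (abs_payoff_le hM t ω γ) (abs_payoff_le hM t ω γ')
      fun ω' hω' => by
        rw [payoff_apply, payoff_apply, hγ's]
        rcases le_total s (γ ω') with h1 | h1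
        · rw [max_eq_left h1]
          linarith
        rw [max_eq_right h1]
        set w := concat t.zero_le ω ω' with hwdef
        suffices hs : |stopAt Y τ (γ ω') w - stopAt Y τ s w| ≤ ε / 4 by linarith [abs_le.mp hs]
        unfold stopAt
        -- If the horizon `τ` has passed, delaying changes nothing.
        rcases le_total (τ w) (γ ω') with h2 | h2
        · rw [min_eq_left h2, min_eq_left (h2.trans h1), sub_self, abs_zero]
          exact hε4.le
        rw [min_eq_right h2]
        have h3 : t ≤ γ ω' := γ.ge_start ω'
        have h4 : γ ω' ≤ min (τ w) s := le_min h2 h1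
        refine hYc _ _ _ _ ?_ ?_
        · have e1 : (t : ℝ) ≤ γ ω' := h3
          have e2 : (γ ω' : ℝ) ≤ (min (τ w) s : Time T) := h4
          have e3 : ((min (τ w) s : Time T) : ℝ) ≤ s :=
            Subtype.coe_le_coe.mpr (min_le_right _ _)
          rw [abs_le]
          constructor <;> linarith
        · intro r
          refine (w.norm_min_sub_min_le (K := 3 * c') (by positivity) ?_ r).trans (by linarith)
          rw [min_eq_left h4, max_eq_right h4]
          intro a b ha ha' hb hb'
          exact hw ω' hω' a b (h3.trans ha) (ha'.trans (min_le_right _ _)) (h3.trans hb)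
            (hb'.trans (min_le_right _ _))
    simp only [integral_const, probReal_univ, one_smul] at k1
    linarith

/-- Change the path first, by an estimate uniform in time, then the time along the fixed path `p.2`.
-/
theorem InS.continuous_snell (hY : InS Y τ) (hP2 : P2 𝒞) (hP3 : P3 𝒞) (hP4 : P4 𝒞)
    (hne : ∀ t, (𝒞 t).Nonempty) :
    Continuous fun p : Time T × Omega d (0 : Time T) => snell 𝒞 (stopAt Y τ) p.1 p.2 := by
  refine Metric.continuous_iff.mpr fun p ε hε => ?_
  have hε3 : 0 < ε / 3 := by positivity
  obtain ⟨η, hη, h1⟩ := hY.snell_regular hP2 hne p.2 hε3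
  obtain ⟨h, hh, h2⟩ := hY.snell_time_regular hP2 hP3 hP4 hne p.2 hε3
  refine ⟨min η h, by positivity, fun q hq => ?_⟩
  have e1 := ((max_lt_iff.mp hq).1.trans_le (min_le_right _ _)).le
  have e2 := ((max_lt_iff.mp hq).2.trans_le (min_le_left _ _)).le
  rw [Subtype.dist_eq, Real.dist_eq, abs_le] at e1
  rw [dist_comm] at e2
  have k1 := abs_le.mp (h1 q.1 q.2 fun r _ => (p.2.norm_sub_le_dist q.2 r).trans e2)
  have k2 : |snell 𝒞 (stopAt Y τ) q.1 p.2 - snell 𝒞 (stopAt Y τ) p.1 p.2| ≤ ε / 3 := by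
    rcases le_total q.1 p.1 with hqp | hqp
    · exact h2 _ _ hqp (by linarith)
    · rw [abs_sub_comm]
      exact h2 _ _ hqp (by linarith)
  have k3 := abs_le.mp k2
  rw [Real.dist_eq, abs_lt]
  constructor <;> linarith

theorem snell_zero_eq (ω ω₁ : Omega d (0 : Time T)) :
    snell 𝒞 (stopAt Y τ) 0 ω = snell 𝒞 (stopAt Y τ) 0 ω₁ :=
  snell_congr fun _ hr => by rw [Omega.eval_of_le _ hr, Omega.eval_of_le _ hr]

/-- The supermartingale property under the laws of `𝒞 0`. -/
theorem InS.integral_indicator_snell_le (hY : InS Y τ) (hP2 : P2 𝒞) (hP3 : P3 𝒞) (hP4 : P4 𝒞)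
    (hne : ∀ t, (𝒞 t).Nonempty) {t s : Time T} (hts : t < s)
    {P : ProbabilityMeasure (Omega d (0 : Time T))} (hP : P ∈ 𝒞 0)
    {A : Set (Omega d (0 : Time T))} (hA : MeasurableSet[filt d 0 t] A) :
    ∫ ω, A.indicator (fun ω => snell 𝒞 (stopAt Y τ) s ω) ω ∂P.toMeasure ≤
      ∫ ω, A.indicator (fun ω => snell 𝒞 (stopAt Y τ) t ω) ω ∂P.toMeasure := by
  obtain ⟨M, hM0, hM⟩ := hY.bounded
  have hZs := (hY.continuous_snell_right hP2 hne s).measurable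
  have hZt := (hY.continuous_snell_right hP2 hne t).measurable
  obtain ⟨hA', hAinv⟩ := measurableSet_filt_iff.mp hA
  -- (P3) conditions only at strictly later times, so time 0 is separate: there all paths vanish and
  -- an event is empty or everything.
  rcases t.zero_le.eq_or_lt with rfl | ht
  · rcases A.eq_empty_or_nonempty with rfl | ⟨ω₁, hω₁⟩
    · simp
    · have : A = Set.univ := Set.eq_univ_of_forall fun ω => hAinv ω₁ ω (fun r hr => by
        rw [Omega.eval_of_le _ hr, Omega.eval_of_le _ hr]) hω₁
      have h1 := hY.integral_snell_le hP2 hP4 hne hts ω₁ hP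
      simp only [concat_zero] at h1
      simp only [this, Set.indicator_univ]
      refine h1.trans (le_of_eq ?_)
      rw [integral_congr_ae (ae_of_all _ fun ω => snell_zero_eq ω ω₁)]
      simp
  · classical
    have hb : ∀ (x : ℝ) (ω : Omega d (0 : Time T)), |x| ≤ M →
        |A.indicator (fun _ => x) ω| ≤ M := fun x ω hx => by
      by_cases hω : ω ∈ A
      · rwa [Set.indicator_of_mem hω]
      · rw [Set.indicator_of_notMem hω, abs_zero]
        exact hM0.le
    have h1 := hP3.integral_le ht hP
      (h := fun ω ω' => A.indicator (fun _ => snell 𝒞 (stopAt Y τ) s (concat t.zero_le ω ω')) ω)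
      (M := M) ?_ ?_ (fun ω ω' => hb _ _ (abs_snell_le hM hne _ _))
      (g := fun ω => A.indicator (fun _ => snell 𝒞 (stopAt Y τ) t ω) ω)
      (hZt.indicator hA') (fun ω => hb _ _ (abs_snell_le hM hne _ _)) ?_
    · simp only [concat_trunc] at h1
      exact h1
    · exact (hZs.comp (continuous_concat t.zero_le).measurable).indicator (measurable_fst hA')
    · intro ω ω₁ ω' h
      have hiff : ω ∈ A ↔ ω₁ ∈ A := ⟨hAinv _ _ h, hAinv _ _ fun r hr => (h r hr).symm⟩
      by_cases hω : ω ∈ A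
      · rw [Set.indicator_of_mem hω, Set.indicator_of_mem (hiff.mp hω), concat_congr _ _ h]
      · rw [Set.indicator_of_notMem hω, Set.indicator_of_notMem (mt hiff.mpr hω)]
    · intro ω Q hQ
      by_cases hω : ω ∈ A
      · simp only [Set.indicator_of_mem hω]
        exact hY.integral_snell_le hP2 hP4 hne hts ω hQ
      · simp only [Set.indicator_of_notMem hω, integral_zero, le_refl]

end SnellContinuity

/-! ### Optional sampling by discretization -/

section OptionalSampling

variable {d : ℕ} {T : ℝ} [hT : Fact (0 < T)]

/-- The `i`-th point of the grid of mesh `T / (N + 1)`. -/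
def gridPoint (T : ℝ) [hT : Fact (0 < T)] (N i : ℕ) : Time T :=
  Set.projIcc 0 T hT.out.le (i * (T / (N + 1)))

/-- The index of the first grid point at or after `t`. -/
def gridIndex (N : ℕ) (t : Time T) : ℕ := ⌈(t : ℝ) / (T / (N + 1))⌉₊

/-- This Galois connection gives monotonicity of rounding and measurability of the rounded times.
Clamping grid points at `T` is harmless because `t ≤ T`. -/
theorem gridIndex_le_iff {N i : ℕ} {t : Time T} : gridIndex N t ≤ i ↔ t ≤ gridPoint T N i := by
  have hT0 : (0 : ℝ) < T / (N + 1) := div_pos hT.out (by positivity)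
  rw [gridIndex, Nat.ceil_le, div_le_iff₀ hT0, ← Subtype.coe_le_coe, gridPoint, Set.coe_projIcc]
  constructor
  · exact fun h => le_max_of_le_right (le_min t.2.2 h)
  · intro h
    rcases le_max_iff.mp h with h1 | h1
    · exact h1.trans (by positivity)
    · exact h1.trans (min_le_right _ _)

theorem gridIndex_le (N : ℕ) (t : Time T) : gridIndex N t ≤ N + 1 := by
  rw [gridIndex_le_iff, gridPoint, ← Subtype.coe_le_coe, Set.coe_projIcc]
  refine le_max_of_le_right (le_min t.2.2 (t.2.2.trans (le_of_eq ?_)))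
  push_cast
  field_simp

theorem gridPoint_mono (N : ℕ) : Monotone (gridPoint T N) := fun i j hij =>
  Set.monotone_projIcc _ (mul_le_mul_of_nonneg_right (Nat.cast_le.mpr hij)
    (div_pos hT.out (by positivity)).le)

theorem tendsto_gridPoint_gridIndex (t : Time T) :
    Tendsto (fun N => gridPoint T N (gridIndex N t)) atTop (𝓝 t) := by
  have h0 : Tendsto (fun N : ℕ => (t : ℝ) + T / (N + 1)) atTop (𝓝 t) := by
    have := (tendsto_one_div_add_atTop_nhds_zero_nat (𝕜 := ℝ)).const_mul T
    simpa [div_eq_mul_inv] using this.const_add (t : ℝ)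
  rw [tendsto_subtype_rng]
  refine tendsto_of_tendsto_of_tendsto_of_le_of_le tendsto_const_nhds h0
    (fun N => Subtype.coe_le_coe.mpr (gridIndex_le_iff.mp le_rfl)) fun N => ?_
  have hT0 : (0 : ℝ) < T / (N + 1) := div_pos hT.out (by positivity)
  change ((gridPoint T N (gridIndex N t) : Time T) : ℝ) ≤ t + T / (N + 1)
  rw [gridPoint, Set.coe_projIcc]
  refine max_le (add_nonneg t.2.1 hT0.le) ((min_le_right _ _).trans ?_)
  have h1 := (Nat.ceil_lt_add_one (div_nonneg t.2.1 hT0.le)).le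
  calc (gridIndex N t : ℝ) * (T / (N + 1))
      ≤ ((t : ℝ) / (T / (N + 1)) + 1) * (T / (N + 1)) := mul_le_mul_of_nonneg_right h1 hT0.le
    _ = t + T / (N + 1) := by rw [add_mul, div_mul_cancel₀ _ hT0.ne', one_mul]

theorem gridIndex_mono (N : ℕ) : Monotone (gridIndex N : Time T → ℕ) := fun _ _ h =>
  gridIndex_le_iff.mpr (h.trans (gridIndex_le_iff.mp le_rfl))

/-- Rounding up does not look ahead: the rounded time exceeds a grid point exactly when the original
time does. -/
theorem measurableSet_lt_gridIndex {t : Time T} (σ : StopTime d t) (N i : ℕ) :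
    MeasurableSet[filt d t (gridPoint T N i)] {ω | i < gridIndex N (σ ω)} := by
  have : {ω | i < gridIndex N (σ ω)} = {ω | σ ω ≤ gridPoint T N i}ᶜ := by
    ext ω
    simp only [Set.mem_ofPred_eq, Set.mem_compl_iff, ← gridIndex_le_iff, not_le]
  rw [this]
  exact (σ.measurableSet_le _).compl

/-- Optional sampling for bounded continuous supermartingales. -/
theorem integral_stopTime_le_integral_min {Z : Time T → Omega d (0 : Time T) → ℝ}
    (hZ : Continuous fun p : Time T × Omega d (0 : Time T) => Z p.1 p.2) {M : ℝ}
    (hM : ∀ t ω, |Z t ω| ≤ M) (P : Measure (Omega d (0 : Time T))) [IsProbabilityMeasure P]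
    (hsuper : ∀ t s : Time T, t < s → ∀ A : Set (Omega d (0 : Time T)),
      MeasurableSet[filt d 0 t] A →
      ∫ ω, A.indicator (fun ω => Z s ω) ω ∂P ≤ ∫ ω, A.indicator (fun ω => Z t ω) ω ∂P)
    (σ σ' : StopTime d (0 : Time T)) :
    ∫ ω, Z (σ' ω) ω ∂P ≤ ∫ ω, Z (min (σ ω) (σ' ω)) ω ∂P := by
  have hmeas : ∀ {f : Omega d (0 : Time T) → Time T}, Measurable f →
      Measurable fun ω => Z (f ω) ω := fun hf => hZ.measurable.comp (hf.prodMk measurable_id)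
  have hint : ∀ {f : Omega d (0 : Time T) → Time T}, Measurable f →
      Integrable (fun ω => Z (f ω) ω) P := fun hf =>
    integrable_of_bounded (hmeas hf) fun ω => hM _ _
  have hround : ∀ N, Measurable fun t : Time T => gridPoint T N (gridIndex N t) := fun N =>
    ((gridPoint_mono N).comp (gridIndex_mono N)).measurable
  have hround' : ∀ N (σ : StopTime d (0 : Time T)),
      Measurable fun ω => gridPoint T N (gridIndex N (σ ω)) := fun N σ =>
    (hround N).comp σ.measurable
  have hlim : ∀ f : Omega d (0 : Time T) → Time T, Measurable f →
      Tendsto (fun N => ∫ ω, Z (gridPoint T N (gridIndex N (f ω))) ω ∂P) atTop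
        (𝓝 (∫ ω, Z (f ω) ω ∂P)) := by
    intro f hf
    refine tendsto_integral_of_dominated_convergence (fun _ => M)
      (fun N => (hmeas ((hround N).comp hf)).aestronglyMeasurable) (integrable_const _)
      (fun N => ae_of_all _ fun ω => hM _ _) (ae_of_all _ fun ω => ?_)
    exact (hZ.tendsto (f ω, ω)).comp
      ((tendsto_gridPoint_gridIndex (f ω)).prodMk_nhds tendsto_const_nhds)
  refine le_of_tendsto_of_tendsto' (hlim σ' σ'.measurable)
    (hlim (fun ω => min (σ ω) (σ' ω)) (σ.measurable.min σ'.measurable)) fun N => ?_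
  set k : Omega d (0 : Time T) → ℕ := fun ω => gridIndex N (σ ω)
  set k' : Omega d (0 : Time T) → ℕ := fun ω => gridIndex N (σ' ω)
  -- The event that step `i` lies between the rounded `σ ∧ σ'` and the rounded `σ'`. It is known at
  -- grid point `i`, so each telescoped increment has nonpositive mean.
  let A : ℕ → Set (Omega d (0 : Time T)) := fun i => {ω | i < k ω}ᶜ ∩ {ω | i < k' ω}
  have hA : ∀ i, MeasurableSet[filt d 0 (gridPoint T N i)] (A i) := fun i =>
    (measurableSet_lt_gridIndex σ N i).compl.inter (measurableSet_lt_gridIndex σ' N i)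
  have htel : ∀ ω, Z (gridPoint T N (k' ω)) ω - Z (gridPoint T N (gridIndex N (min (σ ω) (σ' ω)))) ω
      = ∑ i ∈ Finset.range (N + 1), ((A i).indicator (fun ω => Z (gridPoint T N (i + 1)) ω) ω -
          (A i).indicator (fun ω => Z (gridPoint T N i) ω) ω) := by
    intro ω
    have h1 : gridIndex N (min (σ ω) (σ' ω)) = min (k ω) (k' ω) := (gridIndex_mono N).map_min
    rw [h1, ← Finset.sum_Ico_sub (fun i => Z (gridPoint T N i) ω) (min_le_right (k ω) (k' ω))]
    have h2 : Finset.Ico (min (k ω) (k' ω)) (k' ω) =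
        (Finset.range (N + 1)).filter fun i => k ω ≤ i ∧ i < k' ω := by
      ext i
      have := gridIndex_le N (σ' ω)
      simp only [Finset.mem_Ico, Finset.mem_filter, Finset.mem_range]
      change k' ω ≤ N + 1 at this
      omega
    rw [h2, Finset.sum_filter]
    refine Finset.sum_congr rfl fun i _ => ?_
    by_cases h : k ω ≤ i ∧ i < k' ω
    · have : ω ∈ A i := ⟨not_lt.mpr h.1, h.2⟩
      rw [if_pos h, Set.indicator_of_mem this, Set.indicator_of_mem this]
    · have : ω ∉ A i := fun hω => h ⟨not_lt.mp hω.1, hω.2⟩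
      rw [if_neg h, Set.indicator_of_notMem this, Set.indicator_of_notMem this, sub_zero]
  have hAi : ∀ i t, Integrable ((A i).indicator fun ω => Z t ω) P := fun i t =>
    (hint measurable_const).indicator ((filt d 0).le _ _ (hA i))
  rw [← sub_nonpos, ← integral_sub (hint (hround' N σ'))
    (by exact hint ((hround N).comp (σ.measurable.min σ'.measurable)))]
  simp only [k'] at htel
  simp only [htel]
  rw [integral_finsetSum _ fun i _ => by exact (hAi i _).sub (hAi i _)]
  refine Finset.sum_nonpos fun i _ => ?_
  rw [integral_sub (hAi i _) (hAi i _), sub_nonpos]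
  rcases (gridPoint_mono (T := T) N (Nat.le_succ i)).eq_or_lt with h | h
  · exact le_of_eq (by rw [← Nat.succ_eq_add_one, ← h])
  · exact hsuper _ _ h _ (hA i)

variable {Y : Time T → Omega d (0 : Time T) → ℝ} {τ : StopTime d (0 : Time T)}
  {𝒞 : ∀ t : Time T, Set (ProbabilityMeasure (Omega d t))}

theorem InS.integral_snell_stopTime_le (hY : InS Y τ) (hP2 : P2 𝒞) (hP3 : P3 𝒞) (hP4 : P4 𝒞)
    (hne : ∀ t, (𝒞 t).Nonempty) {P : ProbabilityMeasure (Omega d (0 : Time T))} (hP : P ∈ 𝒞 0)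
    (σ σ' : StopTime d (0 : Time T)) :
    ∫ ω, snell 𝒞 (stopAt Y τ) (σ' ω) ω ∂P.toMeasure ≤
      ∫ ω, snell 𝒞 (stopAt Y τ) (min (σ ω) (σ' ω)) ω ∂P.toMeasure := by
  obtain ⟨M, hM0, hM⟩ := hY.bounded
  exact integral_stopTime_le_integral_min (hY.continuous_snell hP2 hP3 hP4 hne)
    (abs_snell_le hM hne) P.toMeasure
    (fun t s hts A hA => hY.integral_indicator_snell_le hP2 hP3 hP4 hne hts hP hA) σ σ'

theorem InS.integral_snell_stopTime_le_zero (hY : InS Y τ) (hP2 : P2 𝒞) (hP3 : P3 𝒞)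
    (hP4 : P4 𝒞) (hne : ∀ t, (𝒞 t).Nonempty) {P : ProbabilityMeasure (Omega d (0 : Time T))}
    (hP : P ∈ 𝒞 0) (σ : StopTime d (0 : Time T)) (ω₀ : Omega d (0 : Time T)) :
    ∫ ω, snell 𝒞 (stopAt Y τ) (σ ω) ω ∂P.toMeasure ≤ snell 𝒞 (stopAt Y τ) 0 ω₀ := by
  refine (hY.integral_snell_stopTime_le hP2 hP3 hP4 hne hP
    (StopTime.const d le_rfl) σ).trans (le_of_eq ?_)
  have : ∀ ω, snell 𝒞 (stopAt Y τ) (min (StopTime.const d le_rfl ω) (σ ω)) ω =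
      snell 𝒞 (stopAt Y τ) 0 ω₀ := fun ω => by
    rw [min_eq_left (show StopTime.const d le_rfl ω ≤ σ ω from (σ ω).zero_le)]
    exact snell_zero_eq ω ω₀
  simp only [this, integral_const, probReal_univ, one_smul]

end OptionalSampling

/-! ### Hitting times of varying levels -/

section Hitting

variable {d : ℕ} {T : ℝ} [Fact (0 < T)]

/-- The first times a continuous adapted process is at most `a⁺` are stopping times, jointly lower
semicontinuous in the level and the path. -/
theorem exists_hitting {D : Time T → Omega d (0 : Time T) → ℝ}
    (hD : Continuous fun p : Time T × Omega d (0 : Time T) => D p.1 p.2)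
    (hadapt : ∀ t ω ω', (∀ r ≤ t, ω r = ω' r) → D t ω = D t ω')
    (hend : ∃ u, ∀ ω, D u ω ≤ 0) :
    ∃ H : ℝ → StopTime d (0 : Time T), (∀ a ω, IsLeast {t | D t ω ≤ max a 0} (H a ω)) ∧
      ∀ r, IsClosed {p : ℝ × Omega d (0 : Time T) | H p.1 p.2 ≤ r} := by
  obtain ⟨u, hu⟩ := hend
  -- The level `max a 0` keeps the set nonempty for every real `a`, by `hu`; compactness of time
  -- provides the least element.
  have hex : ∀ (a : ℝ) (ω : Omega d (0 : Time T)), ∃ t, IsLeast {t | D t ω ≤ max a 0} t := by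
    intro a ω
    refine IsCompact.exists_isLeast (IsClosed.isCompact ?_) ⟨u, (hu ω).trans (le_max_right _ _)⟩
    exact isClosed_le (hD.comp (by fun_prop : Continuous fun t : Time T => (t, ω)))
      continuous_const
  choose H hH using hex
  have hle : ∀ a ω r, H a ω ≤ r ↔ ∃ t ≤ r, D t ω ≤ max a 0 := fun a ω r =>
    ⟨fun h => ⟨H a ω, h, (hH a ω).1⟩, fun ⟨t, ht, h⟩ => ((hH a ω).2 h).trans ht⟩
  -- Being attained, the hitting time is at most `r` exactly when the level is met by `r`: a
  -- projection of a closed set along compact time.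
  have hcl : ∀ r, IsClosed {p : ℝ × Omega d (0 : Time T) | H p.1 p.2 ≤ r} := by
    intro r
    have h1 : IsClosed {q : Time T × (ℝ × Omega d (0 : Time T)) |
        q.1 ≤ r ∧ D q.1 q.2.2 ≤ max q.2.1 0} := by
      have a1 : Continuous fun q : Time T × (ℝ × Omega d (0 : Time T)) => D q.1 q.2.2 :=
        hD.comp (continuous_fst.prodMk (continuous_snd.comp continuous_snd))
      have a2 : Continuous fun q : Time T × (ℝ × Omega d (0 : Time T)) => max q.2.1 0 :=
        (continuous_fst.comp continuous_snd).max continuous_const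
      exact (isClosed_le continuous_fst continuous_const).inter (isClosed_le a1 a2)
    have h2 := isClosedMap_snd_of_compactSpace _ h1
    convert h2 using 1
    ext p
    simp only [Set.mem_ofPred_eq, hle, Set.mem_image, Prod.exists, exists_eq_right]
  refine ⟨fun a => StopTime.mk' (H a) (fun ω => (H a ω).zero_le) ?_ ?_, hH, hcl⟩
  · refine measurable_of_Iic fun r => IsClosed.measurableSet ?_
    exact (hcl r).preimage (by fun_prop : Continuous fun ω : Omega d (0 : Time T) => (a, ω))
  · intro ω ω' h
    refine (hle _ _ _).mpr ⟨H a ω, le_rfl, ?_⟩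
    rw [← hadapt _ _ _ h]
    exact (hH a ω).1

section Level

variable {D : Time T → Omega d (0 : Time T) → ℝ}
  {H : ℝ → StopTime d (0 : Time T)}

theorem hitting_antitone (hH : ∀ a ω, IsLeast {t | D t ω ≤ max a 0} (H a ω))
    (ω : Omega d (0 : Time T)) : Antitone fun a => H a ω := fun a b hab =>
  (hH b ω).2 ((hH a ω).1.trans (max_le_max hab le_rfl))

theorem measurable_hitting
    (hcl : ∀ r, IsClosed {p : ℝ × Omega d (0 : Time T) | H p.1 p.2 ≤ r}) :
    Measurable fun p : ℝ × Omega d (0 : Time T) => H p.1 p.2 :=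
  measurable_of_Iic fun r => (hcl r).measurableSet

/-- Monotonicity in the level keeps the times below that of level 0; lower semicontinuity in the
level forbids a gap. -/
theorem tendsto_hitting_zero (hH : ∀ a ω, IsLeast {t | D t ω ≤ max a 0} (H a ω))
    (hcl : ∀ r, IsClosed {p : ℝ × Omega d (0 : Time T) | H p.1 p.2 ≤ r})
    (ω : Omega d (0 : Time T)) {b : ℕ → ℝ} (hb : ∀ n, 0 ≤ b n) (hb0 : Tendsto b atTop (𝓝 0)) :
    Tendsto (fun n => H (b n) ω) atTop (𝓝 (H 0 ω)) := by
  refine tendsto_order.mpr ⟨fun r hr => ?_, fun r hr => Eventually.of_forall fun n =>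
    (hitting_antitone hH ω (hb n)).trans_lt hr⟩
  have h1 : ∀ᶠ a in 𝓝 (0 : ℝ), r < H a ω := by
    have h2 : IsOpen {a : ℝ | r < H a ω} := by
      have h3 := ((hcl r).preimage (by fun_prop : Continuous fun a : ℝ => (a, ω))).isOpen_compl
      convert h3 using 1
      ext a
      simp
    exact h2.mem_nhds hr
  exact hb0.eventually h1

/-- Lower semicontinuity always holds. For upper semicontinuity, continuity in the level lets a
slightly smaller level be met before `r`; there `D` is strictly below `a`, which persists for nearby
paths. -/
theorem continuousAt_hitting (hD : Continuous fun p : Time T × Omega d (0 : Time T) => D p.1 p.2)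
    (hH : ∀ a ω, IsLeast {t | D t ω ≤ max a 0} (H a ω))
    (hcl : ∀ r, IsClosed {p : ℝ × Omega d (0 : Time T) | H p.1 p.2 ≤ r}) {a : ℝ} (ha : 0 < a)
    {ω : Omega d (0 : Time T)} (hc : ContinuousAt (fun a => H a ω) a) :
    ContinuousAt (fun ω => H a ω) ω := by
  refine tendsto_order.mpr ⟨fun r hr => ?_, fun r hr => ?_⟩
  · have h2 : IsOpen {ω : Omega d (0 : Time T) | r < H a ω} := by
      have h3 := ((hcl r).preimage
        (by fun_prop : Continuous fun ω : Omega d (0 : Time T) => (a, ω))).isOpen_compl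
      convert h3 using 1
      ext ω
      simp
    exact h2.mem_nhds hr
  · have h1 : ∀ᶠ a' in 𝓝[<] a, H a' ω < r ∧ 0 < a' ∧ a' < a := by
      refine ((hc.eventually (gt_mem_nhds hr)).filter_mono nhdsWithin_le_nhds).and
        (((lt_mem_nhds ha).filter_mono nhdsWithin_le_nhds).and self_mem_nhdsWithin)
    obtain ⟨a', h2, h3, h4⟩ := h1.exists
    have h5 : D (H a' ω) ω < a := by
      refine lt_of_le_of_lt (hH a' ω).1 ?_
      rwa [max_eq_left h3.le]
    have h6 : Continuous fun ω' => D (H a' ω) ω' :=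
      hD.comp (by fun_prop : Continuous fun ω' : Omega d (0 : Time T) => (H a' ω, ω'))
    filter_upwards [h6.continuousAt.eventually (gt_mem_nhds h5)] with ω' h7
    exact ((hH a ω').2 (h7.le.trans (le_max_left _ _))).trans_lt h2

/-- Averaging a process over hitting times of varying levels gives a continuous functional. -/
theorem continuous_integral_hitting
    (hD : Continuous fun p : Time T × Omega d (0 : Time T) => D p.1 p.2)
    (hH : ∀ a ω, IsLeast {t | D t ω ≤ max a 0} (H a ω))
    (hcl : ∀ r, IsClosed {p : ℝ × Omega d (0 : Time T) | H p.1 p.2 ≤ r})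
    {Z : Time T → Omega d (0 : Time T) → ℝ}
    (hZ : Continuous fun p : Time T × Omega d (0 : Time T) => Z p.1 p.2) {M : ℝ}
    (hM : ∀ t ω, |Z t ω| ≤ M) {b c : ℝ} (hb : 0 < b) :
    Continuous fun ω => ∫ a in Set.Ioc b c, Z (H a ω) ω := by
  refine continuous_iff_continuousAt.mpr fun ω₀ => ?_
  refine continuousAt_of_dominated (bound := fun _ => M) (Eventually.of_forall fun ω => ?_)
    (Eventually.of_forall fun ω => ae_of_all _ fun a => hM _ _) (integrable_const _) ?_
  · refine (hZ.measurable.comp (Measurable.prodMk ?_ measurable_const)).aestronglyMeasurable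
    exact (measurable_hitting hcl).comp (measurable_id.prodMk measurable_const)
  -- A monotone function has countably many discontinuities, so almost every level is good at the
  -- given path `ω₀`.
  · have h1 := (hitting_antitone hH ω₀).countable_not_continuousAt.ae_notMem
      (volume.restrict (Set.Ioc b c))
    filter_upwards [h1, ae_restrict_mem measurableSet_Ioc] with a h2 h3
    have h4 : ContinuousAt (fun ω => H a ω) ω₀ :=
      continuousAt_hitting hD hH hcl (hb.trans h3.1) (not_not.mp h2)
    exact ContinuousAt.comp (f := fun ω => (H a ω, ω))
      (g := fun p : Time T × Omega d (0 : Time T) => Z p.1 p.2) hZ.continuousAt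
      (h4.prodMk continuousAt_id)

theorem integral_integral_hitting_swap
    (hcl : ∀ r, IsClosed {p : ℝ × Omega d (0 : Time T) | H p.1 p.2 ≤ r})
    {Z : Time T → Omega d (0 : Time T) → ℝ}
    (hZ : Continuous fun p : Time T × Omega d (0 : Time T) => Z p.1 p.2) {M : ℝ}
    (hM : ∀ t ω, |Z t ω| ≤ M) (b c : ℝ) (P : Measure (Omega d (0 : Time T)))
    [IsProbabilityMeasure P] :
    Integrable (fun a => ∫ ω, Z (H a ω) ω ∂P) (volume.restrict (Set.Ioc b c)) ∧
    ∫ ω, (∫ a in Set.Ioc b c, Z (H a ω) ω) ∂P = ∫ a in Set.Ioc b c, ∫ ω, Z (H a ω) ω ∂P := by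
  have h1 : Integrable (fun p : ℝ × Omega d (0 : Time T) => Z (H p.1 p.2) p.2)
      ((volume.restrict (Set.Ioc b c)).prod P) :=
    integrable_of_bounded (hZ.measurable.comp ((measurable_hitting hcl).prodMk measurable_snd))
      fun p => hM _ _
  exact ⟨h1.integral_prod_left, (integral_integral_swap (f := fun a ω => Z (H a ω) ω) h1).symm⟩

theorem tendsto_integral_hitting_zero (hH : ∀ a ω, IsLeast {t | D t ω ≤ max a 0} (H a ω))
    (hcl : ∀ r, IsClosed {p : ℝ × Omega d (0 : Time T) | H p.1 p.2 ≤ r})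
    {Z : Time T → Omega d (0 : Time T) → ℝ}
    (hZ : Continuous fun p : Time T × Omega d (0 : Time T) => Z p.1 p.2) {M : ℝ}
    (hM : ∀ t ω, |Z t ω| ≤ M) (P : Measure (Omega d (0 : Time T))) [IsProbabilityMeasure P]
    {b : ℕ → ℝ} (hb : ∀ n, 0 ≤ b n) (hb0 : Tendsto b atTop (𝓝 0)) :
    Tendsto (fun n => ∫ ω, Z (H (b n) ω) ω ∂P) atTop (𝓝 (∫ ω, Z (H 0 ω) ω ∂P)) := by
  refine tendsto_integral_of_dominated_convergence (fun _ => M)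
    (fun n => (hZ.measurable.comp
      ((H (b n)).measurable.prodMk measurable_id)).aestronglyMeasurable) (integrable_const _)
    (fun n => ae_of_all _ fun ω => hM _ _) (ae_of_all _ fun ω => ?_)
  exact (hZ.tendsto (H 0 ω, ω)).comp
    ((tendsto_hitting_zero hH hcl ω hb hb0).prodMk_nhds tendsto_const_nhds)

end Level

end Hitting

/-! ### The optimal law, by weak compactness -/

section Optimality

variable {d : ℕ} {T : ℝ} [Fact (0 < T)] {Y : Time T → Omega d (0 : Time T) → ℝ}
  {τ : StopTime d (0 : Time T)} {𝒞 : ∀ t : Time T, Set (ProbabilityMeasure (Omega d t))}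

theorem payoff_zero (ω₀ : Omega d (0 : Time T)) (γ : StopTime d (0 : Time T)) :
    payoff Y τ 0 ω₀ γ = fun ω => stopAt Y τ (γ ω) ω := by
  funext ω
  rw [payoff_apply, concat_zero]

theorem measurable_comp_stopTime {Z : Time T → Omega d (0 : Time T) → ℝ}
    (hZ : Continuous fun p : Time T × Omega d (0 : Time T) => Z p.1 p.2)
    (σ : StopTime d (0 : Time T)) : Measurable fun ω => Z (σ ω) ω :=
  hZ.measurable.comp (σ.measurable.prodMk measurable_id)

/-- Under a nearly optimal law, little is lost by waiting until the envelope is close to the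
payoff. -/
theorem InS.le_integral_snell_hitting (hY : InS Y τ) (hP2 : P2 𝒞) (hP3 : P3 𝒞) (hP4 : P4 𝒞)
    (hne : ∀ t, (𝒞 t).Nonempty) {M : ℝ} (hM0 : 0 < M) (hM : ∀ t ω, |Y t ω| ≤ M)
    {P : ProbabilityMeasure (Omega d (0 : Time T))} (hP : P ∈ 𝒞 0)
    {γ σ : StopTime d (0 : Time T)} {a ε : ℝ} (ha : 0 < a) {ω₀ : Omega d (0 : Time T)}
    (hσ : ∀ ω, γ ω < σ ω → a ≤ snell 𝒞 (stopAt Y τ) (γ ω) ω - stopAt Y τ (γ ω) ω)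
    (hε : snell 𝒞 (stopAt Y τ) 0 ω₀ - ε ≤ ∫ ω, stopAt Y τ (γ ω) ω ∂P.toMeasure) :
    snell 𝒞 (stopAt Y τ) 0 ω₀ - ε - 2 * M / a * ε ≤
      ∫ ω, snell 𝒞 (stopAt Y τ) (σ ω) ω ∂P.toMeasure := by
  have hZ := hY.continuous_snell hP2 hP3 hP4 hne
  have hint : ∀ σ : StopTime d (0 : Time T),
      Integrable (fun ω => snell 𝒞 (stopAt Y τ) (σ ω) ω) P.toMeasure := fun σ =>
    integrable_of_bounded (measurable_comp_stopTime hZ σ) fun ω => abs_snell_le hM hne _ _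
  have hYi : Integrable (fun ω => stopAt Y τ (γ ω) ω) P.toMeasure :=
    integrable_of_bounded (measurable_comp_stopTime hY.continuous_stopAt γ) fun ω => hM _ _
  have h1 := hY.integral_snell_stopTime_le_zero hP2 hP3 hP4 hne hP γ ω₀
  have h2 := hY.integral_snell_stopTime_le hP2 hP3 hP4 hne hP σ γ
  have h3 : ∫ ω, stopAt Y τ (γ ω) ω ∂P.toMeasure ≤
      ∫ ω, snell 𝒞 (stopAt Y τ) (γ ω) ω ∂P.toMeasure :=
    integral_mono hYi (hint γ) fun ω => hY.stopAt_le_snell hne _ _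
  -- Where `γ < σ`, replacing Z at `γ` by Z at `σ` loses at most `2 * M`, hence at most `2 * M / a`
  -- times the gap Z - Ŷ at `γ`, whose mean is at most `ε`.
  have h4 : ∫ ω, snell 𝒞 (stopAt Y τ) (min (σ ω) (γ ω)) ω ∂P.toMeasure ≤
      ∫ ω, (snell 𝒞 (stopAt Y τ) (σ ω) ω + 2 * M / a *
        (snell 𝒞 (stopAt Y τ) (γ ω) ω - stopAt Y τ (γ ω) ω)) ∂P.toMeasure := by
    refine integral_mono (hint (σ.min γ)) ((hint σ).add (((hint γ).sub hYi).const_mul _))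
      fun ω => ?_
    have e0 := hY.stopAt_le_snell hne (γ ω) ω
    change snell 𝒞 (stopAt Y τ) (min (σ ω) (γ ω)) ω ≤ _
    rcases lt_or_ge (γ ω) (σ ω) with h | h
    · rw [min_eq_right h.le]
      have e1 := abs_le.mp (abs_snell_le (τ := τ) hM hne (γ ω) ω)
      have e2 := abs_le.mp (abs_snell_le (τ := τ) hM hne (σ ω) ω)
      have e3 : 2 * M / a * a ≤ 2 * M / a *
          (snell 𝒞 (stopAt Y τ) (γ ω) ω - stopAt Y τ (γ ω) ω) :=
        mul_le_mul_of_nonneg_left (hσ ω h) (by positivity)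
      rw [div_mul_cancel₀ _ ha.ne'] at e3
      linarith
    · rw [min_eq_left h]
      have : 0 ≤ 2 * M / a * (snell 𝒞 (stopAt Y τ) (γ ω) ω - stopAt Y τ (γ ω) ω) :=
        mul_nonneg (by positivity) (sub_nonneg.mpr e0)
      linarith
  rw [integral_add (hint σ) (by exact ((hint γ).sub hYi).const_mul _), integral_const_mul,
    integral_sub (hint γ) hYi] at h4
  have h5 : 2 * M / a * (∫ ω, snell 𝒞 (stopAt Y τ) (γ ω) ω ∂P.toMeasure -
      ∫ ω, stopAt Y τ (γ ω) ω ∂P.toMeasure) ≤ 2 * M / a * ε :=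
    mul_le_mul_of_nonneg_left (by linarith) (by positivity)
  linarith

/-- An optimal law for the first time at which the Snell envelope meets the payoff. -/
theorem InS.exists_optimal (hY : InS Y τ) (hP1 : P1 𝒞) (hP2 : P2 𝒞) (hP3 : P3 𝒞) (hP4 : P4 𝒞)
    (hne : ∀ t, (𝒞 t).Nonempty) :
    ∃ ν : StopTime d (0 : Time T),
      (∀ ω, IsLeast {t : Time T | snell 𝒞 (stopAt Y τ) t ω = stopAt Y τ t ω} (ν ω)) ∧
      ∃ P ∈ 𝒞 0, ∀ ω₀, snell 𝒞 (stopAt Y τ) 0 ω₀ ≤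
        ∫ ω, snell 𝒞 (stopAt Y τ) (ν ω) ω ∂P.toMeasure := by
  obtain ⟨M, hM0, hM⟩ := hY.bounded
  have hT : 0 < T := Fact.out
  set Z := snell 𝒞 (stopAt Y τ) with hZdef
  have hZ : Continuous fun p : Time T × Omega d (0 : Time T) => Z p.1 p.2 :=
    hY.continuous_snell hP2 hP3 hP4 hne
  have hZM : ∀ t ω, |Z t ω| ≤ M := abs_snell_le hM hne
  have hD : Continuous fun p : Time T × Omega d (0 : Time T) => Z p.1 p.2 - stopAt Y τ p.1 p.2 :=
    hZ.sub hY.continuous_stopAt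
  obtain ⟨H, hH, hcl⟩ := exists_hitting (D := fun t ω => Z t ω - stopAt Y τ t ω) hD
    (fun t ω ω' h => by
      rw [hZdef, snell_congr h, hY.stopAt_congr h])
    ⟨⟨T, hT.le, le_rfl⟩, fun ω => (sub_eq_zero.mpr (hY.snell_terminal hne rfl ω)).le⟩
  have ω₀ : Omega d (0 : Time T) := Classical.arbitrary _
  have hseq : ∀ m : ℕ, ∃ P ∈ 𝒞 0, ∃ γ : StopTime d (0 : Time T),
      Z 0 ω₀ - 1 / ((m : ℝ) + 1) ≤ ∫ ω, stopAt Y τ (γ ω) ω ∂P.toMeasure := by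
    intro m
    obtain ⟨P, hP, γ, h⟩ := exists_lt_payoff (Y := Y) (τ := τ) hne 0 ω₀
      (sub_lt_self _ (show 0 < 1 / ((m : ℝ) + 1) by positivity))
    rw [payoff_zero] at h
    exact ⟨P, hP, γ, h.le⟩
  choose P hP γ hγ using hseq
  -- A limit along a free ultrafilter follows from compactness alone, with no subsequence to
  -- extract.
  obtain ⟨Q, hQ, hlim⟩ : ∃ Q ∈ 𝒞 0, Tendsto P (hyperfilter ℕ : Filter ℕ) (𝓝 Q) := by
    obtain ⟨Q, hQ, h⟩ := IsCompact.ultrafilter_le_nhds (show IsCompact (𝒞 0) from hP1)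
      ((hyperfilter ℕ).map P) (by
        rw [le_principal_iff]
        exact Filter.mem_map.mpr (Filter.univ_mem' hP))
    exact ⟨Q, hQ, h⟩
  -- Averaging over levels in `(b, 2 * b]` yields a functional continuous under weak convergence,
  -- while every level in this range exceeds `b`, so the loss is uniform.
  have hbZ : ∀ b : ℝ, 0 < b → Z 0 ω₀ ≤ ∫ ω, Z (H (2 * b) ω) ω ∂Q.toMeasure := by
    intro b hb
    have hG := continuous_integral_hitting (c := 2 * b) hD hH hcl hZ hZM hb
    have hvol : (volume.restrict (Set.Ioc b (2 * b))).real Set.univ = b := by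
      rw [measureReal_restrict_apply_univ, Real.volume_real_Ioc_of_le (by linarith)]
      ring
    have hGb : ∀ ω, ‖∫ a in Set.Ioc b (2 * b), Z (H a ω) ω‖ ≤ M * b := fun ω => by
      have := norm_integral_le_of_norm_le_const (μ := volume.restrict (Set.Ioc b (2 * b)))
        (f := fun a => Z (H a ω) ω) (C := M) (ae_of_all _ fun a => hZM _ _)
      rwa [hvol] at this
    have h1 := (ProbabilityMeasure.tendsto_iff_forall_integral_tendsto.mp hlim)
      (BoundedContinuousFunction.ofNormedAddCommGroup _ hG (M * b) hGb)
    simp only [BoundedContinuousFunction.coe_ofNormedAddCommGroup] at h1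
    have h2 : ∀ m : ℕ, b * (Z 0 ω₀ - 1 / ((m : ℝ) + 1) - 2 * M / b * (1 / ((m : ℝ) + 1))) ≤
        ∫ ω, (∫ a in Set.Ioc b (2 * b), Z (H a ω) ω) ∂(P m).toMeasure := by
      intro m
      obtain ⟨hi, hs⟩ := integral_integral_hitting_swap hcl hZ hZM b (2 * b) (P m).toMeasure
      rw [hs]
      have h3 : ∫ a in Set.Ioc b (2 * b),
          (Z 0 ω₀ - 1 / ((m : ℝ) + 1) - 2 * M / b * (1 / ((m : ℝ) + 1))) ≤
          ∫ a in Set.Ioc b (2 * b), ∫ ω, Z (H a ω) ω ∂(P m).toMeasure := by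
        refine setIntegral_mono_on (integrable_const _) hi measurableSet_Ioc fun a ha => ?_
        refine hY.le_integral_snell_hitting hP2 hP3 hP4 hne hM0 hM (hP m) (γ := γ m) hb
          (fun ω hω => ?_) (hγ m)
        by_contra hlt
        have hmem : Z (γ m ω) ω - stopAt Y τ (γ m ω) ω ≤ max a 0 :=
          (not_le.mp hlt).le.trans (ha.1.le.trans (le_max_left _ _))
        exact absurd ((hH a ω).2 hmem) (not_le.mpr hω)
      rwa [integral_const, hvol, smul_eq_mul] at h3
    have h4 : Tendsto (fun m : ℕ => b * (Z 0 ω₀ - 1 / ((m : ℝ) + 1) -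
        2 * M / b * (1 / ((m : ℝ) + 1)))) (hyperfilter ℕ : Filter ℕ) (𝓝 (b * Z 0 ω₀)) := by
      have h5 : Tendsto (fun m : ℕ => 1 / ((m : ℝ) + 1)) (hyperfilter ℕ : Filter ℕ) (𝓝 0) :=
        tendsto_one_div_add_atTop_nhds_zero_nat.mono_left Nat.hyperfilter_le_atTop
      have h6 := ((tendsto_const_nhds (x := Z 0 ω₀)).sub h5).sub (h5.const_mul (2 * M / b))
      have h7 := h6.const_mul b
      simpa using h7
    have h8 := le_of_tendsto_of_tendsto' h4 h1 h2
    obtain ⟨hi, hs⟩ := integral_integral_hitting_swap hcl hZ hZM b (2 * b) Q.toMeasure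
    rw [hs] at h8
    -- The time of level `2 * b` comes no later than the others, so by the supermartingale property
    -- under `Q` its value dominates the average.
    have h9 : ∫ a in Set.Ioc b (2 * b), ∫ ω, Z (H a ω) ω ∂Q.toMeasure ≤
        ∫ a in Set.Ioc b (2 * b), ∫ ω, Z (H (2 * b) ω) ω ∂Q.toMeasure := by
      refine setIntegral_mono_on hi (integrable_const _) measurableSet_Ioc fun a ha => ?_
      refine (hY.integral_snell_stopTime_le hP2 hP3 hP4 hne hQ (H (2 * b)) (H a)).trans
        (le_of_eq ?_)
      congr 1
      funext ω
      rw [min_eq_left (hitting_antitone hH ω ha.2)]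
    rw [integral_const, hvol, smul_eq_mul] at h9
    exact le_of_mul_le_mul_left (h8.trans h9) hb
  have hν : ∀ ω, {t : Time T | Z t ω - stopAt Y τ t ω ≤ max 0 0} =
      {t : Time T | Z t ω = stopAt Y τ t ω} := fun ω => by
    ext t
    simp only [max_self, Set.mem_ofPred_eq, sub_nonpos]
    exact ⟨fun h => le_antisymm h (hY.stopAt_le_snell hne t ω), fun h => h.le⟩
  refine ⟨H 0, fun ω => hν ω ▸ hH 0 ω, Q, hQ, fun ω₁ => ?_⟩
  rw [show Z 0 ω₁ = Z 0 ω₀ from snell_zero_eq ω₁ ω₀]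
  have hb0 : Tendsto (fun n : ℕ => 2 * (1 / ((n : ℝ) + 1))) atTop (𝓝 0) := by
    simpa using (tendsto_one_div_add_atTop_nhds_zero_nat (𝕜 := ℝ)).const_mul 2
  have hlim' := tendsto_integral_hitting_zero hH hcl hZ hZM Q.toMeasure
    (fun n : ℕ => (by positivity : (0 : ℝ) ≤ 2 * (1 / ((n : ℝ) + 1)))) hb0
  exact ge_of_tendsto' hlim' fun n => hbZ _ (by positivity)

end Optimality

end RobustStopping

end

/-! ### Conclusion -/

open RobustStopping

theorem theorem4p1 (d : ℕ) (hd : 0 < d) (T : ℝ) [Fact (0 < T)]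
    (𝒞 : ∀ t : Time T, Set (ProbabilityMeasure (Omega d t)))
    (hne : (𝒞 0).Nonempty) (hP1 : P1 𝒞) (hP2 : P2 𝒞) (hP3 : P3 𝒞) (hP4 : P4 𝒞)
    (Y : Time T → Omega d (0 : Time T) → ℝ) (τ : StopTime d (0 : Time T)) (hY : InS Y τ) :
    ∃ ν : StopTime d (0 : Time T),
      (∀ ω, IsLeast {t : Time T | snell 𝒞 (stopAt Y τ) t ω = stopAt Y τ t ω} (ν ω)) ∧
      ∃ P ∈ 𝒞 0,
        (∀ ω₀, snell 𝒞 (stopAt Y τ) 0 ω₀ =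
            nlExp 𝒞 0 (fun ω => snell 𝒞 (stopAt Y τ) (ν ω) ω) ω₀ ∧
          snell 𝒞 (stopAt Y τ) 0 ω₀ = ∫ ω, snell 𝒞 (stopAt Y τ) (ν ω) ω ∂P.toMeasure ∧
          snell 𝒞 (stopAt Y τ) 0 ω₀ = ∫ ω, stopAt Y τ (ν ω) ω ∂P.toMeasure) ∧
        IsGreatest {x : ℝ | ∃ P' ∈ 𝒞 0, ∃ γ : StopTime d (0 : Time T),
            x = ∫ ω, stopAt Y τ (γ ω) ω ∂P'.toMeasure}
          (∫ ω, stopAt Y τ (ν ω) ω ∂P.toMeasure) ∧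
        ∀ ζ : StopTime d (0 : Time T),
          (Measurable (fun ω => snell 𝒞 (stopAt Y τ) (min (ν ω) (ζ ω)) ω) ∧
            ∃ C : ℝ, ∀ ω, |snell 𝒞 (stopAt Y τ) (min (ν ω) (ζ ω)) ω| ≤ C) ∧
          ∀ ω₀, snell 𝒞 (stopAt Y τ) 0 ω₀ =
              nlExp 𝒞 0 (fun ω => snell 𝒞 (stopAt Y τ) (min (ν ω) (ζ ω)) ω) ω₀ ∧
            snell 𝒞 (stopAt Y τ) 0 ω₀ =
              ∫ ω, snell 𝒞 (stopAt Y τ) (min (ν ω) (ζ ω)) ω ∂P.toMeasure := by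
  have hne' := hP3.nonempty hne
  obtain ⟨M, hM0, hM⟩ := hY.bounded
  obtain ⟨ν, hν, P, hP, hopt⟩ := hY.exists_optimal hP1 hP2 hP3 hP4 hne'
  have hZ := hY.continuous_snell hP2 hP3 hP4 hne'
  have hle := fun Q (hQ : Q ∈ 𝒞 0) σ => hY.integral_snell_stopTime_le_zero hP2 hP3 hP4 hne' hQ σ
  -- The supermartingale inequality bounds every law from above, so a lower bound under the single
  -- law `P` already identifies the nonlinear expectation.
  have hnl : ∀ (σ : StopTime d (0 : Time T)) (ω₀ : Omega d (0 : Time T)),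
      snell 𝒞 (stopAt Y τ) 0 ω₀ ≤ ∫ ω, snell 𝒞 (stopAt Y τ) (σ ω) ω ∂P.toMeasure →
      snell 𝒞 (stopAt Y τ) 0 ω₀ = nlExp 𝒞 0 (fun ω => snell 𝒞 (stopAt Y τ) (σ ω) ω) ω₀ := by
    intro σ ω₀ h
    have : Nonempty (𝒞 0) := hne.to_subtype
    simp only [nlExp, shiftRV, concat_zero]
    refine le_antisymm (h.trans (le_ciSup (f := fun Q : 𝒞 0 =>
      ∫ ω, snell 𝒞 (stopAt Y τ) (σ ω) ω ∂Q.1.toMeasure) ⟨snell 𝒞 (stopAt Y τ) 0 ω₀, ?_⟩ ⟨P, hP⟩))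
      (ciSup_le fun Q => hle Q.1 Q.2 σ ω₀)
    rintro _ ⟨Q, rfl⟩
    exact hle Q.1 Q.2 σ ω₀
  have hYZ : ∫ ω, stopAt Y τ (ν ω) ω ∂P.toMeasure =
      ∫ ω, snell 𝒞 (stopAt Y τ) (ν ω) ω ∂P.toMeasure :=
    integral_congr_ae (ae_of_all _ fun ω => (hν ω).1.symm)
  have hZν : ∀ ω₀, snell 𝒞 (stopAt Y τ) 0 ω₀ =
      ∫ ω, snell 𝒞 (stopAt Y τ) (ν ω) ω ∂P.toMeasure := fun ω₀ =>
    le_antisymm (hopt ω₀) (hle P hP ν ω₀)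
  refine ⟨ν, hν, P, hP, fun ω₀ => ⟨hnl ν ω₀ (hopt ω₀), hZν ω₀, (hZν ω₀).trans hYZ.symm⟩,
    ⟨⟨P, hP, ν, rfl⟩, ?_⟩, fun ζ => ⟨⟨measurable_comp_stopTime hZ (ν.min ζ), M, fun ω =>
      abs_snell_le hM hne' _ _⟩, fun ω₀ => ?_⟩⟩
  · rintro _ ⟨Q, hQ, γ, rfl⟩
    have ω₀ : Omega d (0 : Time T) := Classical.arbitrary _
    rw [hYZ, ← hZν ω₀]
    have h := hY.le_snell ω₀ hQ γ
    rwa [payoff_zero] at h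
  -- Optional sampling from `ν ∧ ζ` to `ν` squeezes the value at `ν ∧ ζ` between the value at `ν`
  -- and Z at time 0, which coincide.
  · have h1 : snell 𝒞 (stopAt Y τ) 0 ω₀ ≤
        ∫ ω, snell 𝒞 (stopAt Y τ) ((ν.min ζ) ω) ω ∂P.toMeasure := by
      refine (hopt ω₀).trans ((hY.integral_snell_stopTime_le hP2 hP3 hP4 hne' hP ζ ν).trans
        (le_of_eq ?_))
      congr 1
      funext ω
      rw [min_comm]
      rfl
    exact ⟨hnl (ν.min ζ) ω₀ h1, le_antisymm h1 (hle P hP (ν.min ζ) ω₀)⟩
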